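/- **Conventions.** A *tt-category* is an idempotent complete triangulated category $\mathcal K$ with a symmetric monoidal structure $(\otimes,\mathbb 1)$ that is exact in each variable; a *tt-functor* is an exact symmetric (strong) monoidal functor between tt-categories. A *tt-ring* in $\mathcal K$ is a commutative ring object $A$ (with multiplication $\mu$ and unit $\eta$) that is separable, i.e. $\mu:A\otimes A\to A$ has a section which is a morphism of $A,A$-bimodules. The product $A\times B$ is $A\oplus B$ with componentwise structure, $A^{\times n}$ is the $n$-fold product ($A^{\times 0}=0$), and a tt-ring is non-zero if its underlying object is. For a tt-ring $B$, an isomorphism of tt-rings in the tt-category $B\text{-}\mathrm{Mod}_{\mathcal K}$ of $B$-modules (with tensor $\otimes_B$ and unit $\mathbb 1=B$) is the same as an isomorphism of commutative $B$-algebras, i.e. of commutative ring objects of $\mathcal K$ under $B$; $F_B(A)=B\otimes A$ denotes extension of scalars. A *splitting tower* of a tt-ring $A$ is a sequence of tt-rings and homomorphisms $A^{[0]}\to A^{[1]}\to A^{[2]}\to\cdots$ with $A^{[0]}=\mathbb 1$, $A^{[1]}=A$ such that for every $n\ge 1$ there is an isomorphism of $A^{[n]}$-algebras $h:A^{[n]}\otimes_{A^{[n-1]}}A^{[n]}\cong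 A^{[n]}\times A^{[n+1]}$ with $\mathrm{pr}_1 h=\mu$. One says that $A$ has finite degree $d$, and writes $\deg(A)=d$, if $A^{[d]}\ne 0$ and $A^{[d+1]}=0$ for a splitting tower of $A$; if there is no such $d\in\mathbb N$, then $\deg(A)=\infty$. $\mathrm{Spc}(\mathcal K)$ is the set of prime thick $\otimes$-ideals $\mathcal P\subsetneq\mathcal K$ and $\mathrm{supp}(x)=\{\mathcal P\mid x\notin\mathcal P\}$. An object $x$ is $\otimes$-nilpotent if $x^{\otimes m}=0$ for some $m\ge 0$. $\mathcal K$ is *local* if $x\otimes y=0$ implies that $x$ or $y$ is $\otimes$-nilpotent. A tt-functor $F:\mathcal K\to\mathcal L$ is *weakly conservative on* $\mathcal K_{\mathrm{supp}(A)}$ if every $x\in\mathcal K$ with $\mathrm{supp}(x)\subseteq\mathrm{supp}(A)$ and $F(x)=0$ is $\otimes$-nilpotent. **Theorem 3.8.** Let $\mathcal K\neq 0$ be a tt-category and $A$ a tt-ring in $\mathcal K$. Then $A$ has a splitting tower, and the degree may be computed with any splitting tower of $A$: for every splitting tower and every $d\in\mathbb N$ one has $\deg(A)=d$ if and only if $A^{[d]}\neq0$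 and $A^{[d+1]}=0$. Moreover, for every splitting tower of $A$: (a) For every $n\ge 1$, $\deg(\mathbb 1^{\times n})=n$. (b) For every $n\ge 1$, $F_{A^{[n]}}(A)\cong \mathbb 1^{\times n}\times A^{[n+1]}$ as tt-rings in $A^{[n]}\text{-}\mathrm{Mod}_{\mathcal K}$. (c) If $\deg(A)<\infty$, then $B:=A^{[\deg(A)]}$ is non-zero and $F_B(A)\cong\mathbb 1^{\times\deg(A)}$ as tt-rings in $B\text{-}\mathrm{Mod}_{\mathcal K}$. (d) Let $F:\mathcal K\to\mathcal L$ be a tt-functor which is weakly conservative on $\mathcal K_{\mathrm{supp}(A)}$, with $\mathcal L\neq 0$, or which is conservative (reflects isomorphisms). If $F(A)\cong\mathbb 1^{\times d}$ as tt-rings in $\mathcal L$ for some $d\ge 0$, then $\deg(A)=d$. (e) Let $B\neq 0$ be a tt-ring in $\mathcal K$ with $F_B(A)\cong\mathbb 1^{\times d}$ as tt-rings in $B\text{-}\mathrm{Mod}_{\mathcal K}$ for some $d\ge 0$. If $\mathrm{supp}(B)\supseteq\mathrm{supp}(A)$, or if $\mathcal K$ is local, then $\deg(A)=d$. -/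

import Mathlib

open CategoryTheory MonoidalCategory Limits Pretriangulated

open scoped MonObj

universe v u v' u'

namespace TTDegree

/-! ### Tensor-triangulated categories -/

/-- A tensor-triangulated category (always idempotent complete): a triangulated category with a
symmetric monoidal structure whose tensor product is exact in each variable, that is, for every
object `X` the functors `X ⊗ -` and `- ⊗ X` are additive, commute with the shift and send
distinguished triangles to distinguished triangles. -/
class TTCategory (K : Type u) [Category.{v} K] [Preadditive K] [HasZeroObject K] [HasShift K ℤ]
    [∀ n : ℤ, (shiftFunctor K n).Additive] [Pretriangulated K] [MonoidalCategory K]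
    [SymmetricCategory K] : Prop where
  triangulated : IsTriangulated K
  idempotentComplete : IsIdempotentComplete K
  preadditive : MonoidalPreadditive K
  exact_tensorLeft (X : K) :
    ∃ _ : (tensorLeft X).CommShift ℤ, (tensorLeft X).IsTriangulated
  exact_tensorRight (X : K) :
    ∃ _ : (tensorRight X).CommShift ℤ, (tensorRight X).IsTriangulated

section Rings

variable {K : Type u} [Category.{v} K] [MonoidalCategory K]

/-- The underlying morphism of a homomorphism of commutative ring objects. -/
abbrev homOf [BraidedCategory K] {A B : CommMon K} (f : A ⟶ B) : A.X ⟶ B.X := f.hom.hom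

/-- A ring object `A` is separable if its multiplication `μ : A ⊗ A ⟶ A` has a section `σ` which
is a morphism of `A,A`-bimodules. A tt-ring is a commutative ring object (an object of `CommMon K`)
which is separable. -/
class IsSeparableRing (A : K) [MonObj A] : Prop where
  exists_section : ∃ σ : A ⟶ A ⊗ A, σ ≫ μ = 𝟙 A ∧
    μ ≫ σ = (A ◁ σ) ≫ (α_ A A A).inv ≫ (μ ▷ A) ∧
    μ ≫ σ = (σ ▷ A) ≫ (α_ A A A).hom ≫ (A ◁ μ)

/-- Tensor powers `x ⊗ (x ⊗ (⋯ ⊗ 𝟙))` of an object. -/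
def tensorPow (x : K) : ℕ → K
  | 0 => 𝟙_ K
  | n + 1 => x ⊗ tensorPow x n

/-- An object is `⊗`-nilpotent if some tensor power of it vanishes. -/
def IsTensorNilpotent (x : K) : Prop := ∃ m : ℕ, IsZero (tensorPow x m)

variable (K) in
/-- A tt-category is local if `x ⊗ y = 0` implies that `x` or `y` is `⊗`-nilpotent. -/
def IsLocalTT : Prop :=
  ∀ x y : K, IsZero (x ⊗ y) → IsTensorNilpotent x ∨ IsTensorNilpotent y

end Rings

/-! ### Products of commutative ring objects

The ring object `A × B` is `A ⊞ B` with componentwise structure. -/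

noncomputable section Products

section Projection

variable {K : Type u} [Category.{v} K] [MonoidalCategory K] {P A : K} [MonObj A] (p : P ⟶ A)

theorem proj_one_mul (e : 𝟙_ K ⟶ P) (he : e ≫ p = η) :
    (e ▷ P) ≫ (p ⊗ₘ p) ≫ μ = (λ_ P).hom ≫ p := by
  rw [MonoidalCategory.tensorHom_def, Category.assoc, ← comp_whiskerRight_assoc, he,
    ← whisker_exchange_assoc, MonObj.one_mul, leftUnitor_naturality]

theorem proj_mul_one (e : 𝟙_ K ⟶ P) (he : e ≫ p = η) :
    (P ◁ e) ≫ (p ⊗ₘ p) ≫ μ = (ρ_ P).hom ≫ p := by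
  rw [MonoidalCategory.tensorHom_def', Category.assoc,
    ← MonoidalCategory.whiskerLeft_comp_assoc, he, whisker_exchange_assoc, MonObj.mul_one, rightUnitor_naturality]

theorem proj_mul_assoc (m : P ⊗ P ⟶ P) (hm : m ≫ p = (p ⊗ₘ p) ≫ μ) :
    (m ▷ P) ≫ (p ⊗ₘ p) ≫ μ = (α_ P P P).hom ≫ (P ◁ m) ≫ (p ⊗ₘ p) ≫ μ := by
  have h1 : (m ▷ P) ≫ (p ⊗ₘ p) = ((p ⊗ₘ p) ⊗ₘ p) ≫ (μ ▷ A) := by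
    rw [← tensorHom_id, ← tensorHom_id, tensorHom_comp_tensorHom, tensorHom_comp_tensorHom, hm]
    simp
  have h2 : (P ◁ m) ≫ (p ⊗ₘ p) = (p ⊗ₘ (p ⊗ₘ p)) ≫ (A ◁ μ) := by
    rw [← id_tensorHom, ← id_tensorHom, tensorHom_comp_tensorHom, tensorHom_comp_tensorHom, hm]
    simp
  rw [reassoc_of% h1, reassoc_of% h2, MonObj.mul_assoc, associator_naturality_assoc]

theorem proj_mul_comm [BraidedCategory K] [IsCommMonObj A] :
    (β_ P P).hom ≫ (p ⊗ₘ p) ≫ μ = (p ⊗ₘ p) ≫ μ := by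
  rw [← BraidedCategory.braiding_naturality_assoc, IsCommMonObj.mul_comm]

end Projection

variable {K : Type u} [Category.{v} K] [Preadditive K] [MonoidalCategory K]

section Binary

variable [HasBinaryBiproducts K] (A B : K) [MonObj A] [MonObj B]

/-- The componentwise ring structure on `A ⊞ B`. -/
@[simps one mul]
instance prodMonObj : MonObj (A ⊞ B) where
  one := biprod.lift η η
  mul := biprod.lift ((biprod.fst ⊗ₘ biprod.fst) ≫ μ) ((biprod.snd ⊗ₘ biprod.snd) ≫ μ)
  one_mul := by
    ext
    · simp [proj_one_mul]
    · simp [proj_one_mul]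
  mul_one := by
    ext
    · simp [proj_mul_one]
    · simp [proj_mul_one]
  mul_assoc := by
    ext
    · simpa using proj_mul_assoc _ _ (by simp)
    · simpa using proj_mul_assoc _ _ (by simp)

instance prodIsComm [BraidedCategory K] [IsCommMonObj A] [IsCommMonObj B] :
    IsCommMonObj (A ⊞ B) where
  mul_comm := by
    ext
    · simp [proj_mul_comm]
    · simp [proj_mul_comm]

instance isMonHom_fst : IsMonHom (biprod.fst : A ⊞ B ⟶ A) where

instance isMonHom_snd : IsMonHom (biprod.snd : A ⊞ B ⟶ B) where

instance isMonHom_lift {C : K} [MonObj C] (f : C ⟶ A) (g : C ⟶ B) [IsMonHom f] [IsMonHom g] :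
    IsMonHom (biprod.lift f g) where
  one_hom := by ext <;> simp
  mul_hom := by ext <;> simp [tensorHom_comp_tensorHom_assoc]

end Binary

section Finite

variable [HasFiniteBiproducts K] {n : ℕ} (A : Fin n → K) [∀ i, MonObj (A i)]

/-- The componentwise ring structure on `⨁ A`. -/
@[simps one mul]
instance piMonObj : MonObj (⨁ A) where
  one := biproduct.lift fun _ => η
  mul := biproduct.lift fun i => (biproduct.π A i ⊗ₘ biproduct.π A i) ≫ μ
  one_mul := by
    ext
    simp [proj_one_mul]
  mul_one := by
    ext
    simp [proj_mul_one]
  mul_assoc := by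
    ext
    simpa using proj_mul_assoc _ _ (by simp)

instance piIsComm [BraidedCategory K] [∀ i, IsCommMonObj (A i)] : IsCommMonObj (⨁ A) where
  mul_comm := by
    ext
    simp [proj_mul_comm]

instance isMonHom_biproductLift {C : K} [MonObj C] (f : ∀ i, C ⟶ A i) [∀ i, IsMonHom (f i)] :
    IsMonHom (biproduct.lift f) where
  one_hom := by ext; simp
  mul_hom := by ext; simp [tensorHom_comp_tensorHom_assoc]

end Finite

section Bundled

variable [BraidedCategory K]

/-- A homomorphism of commutative ring objects from a morphism compatible with multiplications and
units. -/
abbrev ringHom {M N : K} [MonObj M] [IsCommMonObj M] [MonObj N] [IsCommMonObj N] (f : M ⟶ N)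
    [IsMonHom f] : CommMon.mk M ⟶ CommMon.mk N :=
  CommMon.homMk (Mon.ofHom f)

instance isMonHom_homOf {A B : CommMon K} (f : A ⟶ B) : IsMonHom (homOf f) :=
  f.hom.isMonHom_hom

/-- The product `A × B` of two commutative ring objects. -/
abbrev prodRing [HasBinaryBiproducts K] (A B : CommMon K) : CommMon K where
  X := A.X ⊞ B.X

/-- The first projection `A × B ⟶ A`. -/
abbrev prodFst [HasBinaryBiproducts K] (A B : CommMon K) : prodRing A B ⟶ A :=
  ringHom (biprod.fst : A.X ⊞ B.X ⟶ A.X)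

/-- The second projection `A × B ⟶ B`. -/
abbrev prodSnd [HasBinaryBiproducts K] (A B : CommMon K) : prodRing A B ⟶ B :=
  ringHom (biprod.snd : A.X ⊞ B.X ⟶ B.X)

/-- The homomorphism `(f, g) : C ⟶ A × B`. -/
abbrev prodLift [HasBinaryBiproducts K] {A B C : CommMon K} (f : C ⟶ A) (g : C ⟶ B) :
    C ⟶ prodRing A B :=
  ringHom (biprod.lift (homOf f) (homOf g))

/-- The `n`-fold product `A × ⋯ × A` of a commutative ring object (it is `0` for `n = 0`). -/
abbrev powRing [HasFiniteBiproducts K] (A : CommMon K) (n : ℕ) : CommMon K where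
  X := ⨁ fun _ : Fin n => A.X

/-- The diagonal homomorphism `A ⟶ A × ⋯ × A`. -/
abbrev powDiag [HasFiniteBiproducts K] (A : CommMon K) (n : ℕ) : A ⟶ powRing A n :=
  ringHom (biproduct.lift fun _ : Fin n => 𝟙 A.X)

/-- The ring object `𝟙 × ⋯ × 𝟙` (`n` factors). -/
abbrev unitPow (K : Type u) [Category.{v} K] [Preadditive K] [MonoidalCategory K]
    [BraidedCategory K] [HasFiniteBiproducts K] (n : ℕ) : CommMon K :=
  powRing (CommMon.trivial K) n

end Bundled

end Products

/-! ### Algebras over a tt-ring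

The modules over a tt-ring `B` form a tt-category with tensor product `⊗_B` and unit `B`.
A (commutative) ring object in it is the same thing as a `B`-algebra, i.e. a homomorphism `B ⟶ C`
of commutative ring objects of `K`: the `B`-module is `C` and its multiplication is the map
`C ⊗_B C ⟶ C` induced by that of `C`. The ring objects in `B`-modules and their homomorphisms are
therefore represented by the category `Under B` of `B`-algebras, `B` an object of `CommMon K`. -/

noncomputable section Algebras

variable {K : Type u} [Category.{v} K] [MonoidalCategory K]

instance isMonHom_unit (A : K) [MonObj A] : IsMonHom (η : 𝟙_ K ⟶ A) where
  one_hom := by simp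
  mul_hom := by simp [MonoidalCategory.tensorHom_def, unitors_equal]

instance isMonHom_inclLeft [BraidedCategory K] (B A : K) [MonObj A] [MonObj B] :
    IsMonHom ((ρ_ B).inv ≫ (B ◁ (η : 𝟙_ K ⟶ A))) :=
  inferInstance

/-- The ring homomorphism `b ↦ b ⊗ 1` from `B` to `B ⊗ A`. -/
abbrev inclLeft [SymmetricCategory K] (B A : CommMon K) : B ⟶ (⟨B.X ⊗ A.X⟩ : CommMon K) :=
  ringHom ((ρ_ B.X).inv ≫ (B.X ◁ η[A.X]))

/-- The extension of scalars `F_B(A) = B ⊗ A`, as a ring object in `B`-modules: the product of the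
ring objects `B` and `A`, with `B` acting on the left factor. -/
abbrev extScalars [SymmetricCategory K] (B A : CommMon K) : Under B :=
  Under.mk (inclLeft B A)

variable [Preadditive K]

/-- The product of two ring objects in `B`-modules. -/
abbrev prodAlg [BraidedCategory K] [HasBinaryBiproducts K] {B : CommMon K} (C D : Under B) :
    Under B :=
  Under.mk (prodLift C.hom D.hom)

/-- The ring object `𝟙 × ⋯ × 𝟙` (`n` factors) in `B`-modules, the unit `𝟙` being `B`. -/
abbrev unitPowAlg [BraidedCategory K] [HasFiniteBiproducts K] (B : CommMon K) (n : ℕ) : Under B :=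
  Under.mk (powDiag B n)

end Algebras
/-! ### The splitting tower and the degree -/

noncomputable section Tower

variable {K : Type u} [Category.{v} K] [MonoidalCategory K]

/-- Let `f : R ⟶ S` and `g : R ⟶ S'` be homomorphisms of commutative ring objects. The ring object
`T` with homomorphisms `i : S ⟶ T` and `j : S' ⟶ T` is the relative tensor product `S ⊗_R S'` if
`i · j : S ⊗ S' ⟶ T` is the coequalizer of the two actions `S ⊗ R ⊗ S' ⇉ S ⊗ S'` of `R`. -/
def IsRelTensor [BraidedCategory K] {R S S' T : CommMon K} (f : R ⟶ S) (g : R ⟶ S')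
    (i : S ⟶ T) (j : S' ⟶ T) : Prop :=
  ∃ w : (((S.X ◁ homOf f) ≫ μ[S.X]) ▷ S'.X) ≫ (homOf i ⊗ₘ homOf j) ≫ μ[T.X] =
      ((α_ S.X R.X S'.X).hom ≫ (S.X ◁ ((homOf g ▷ S'.X) ≫ μ[S'.X]))) ≫
        (homOf i ⊗ₘ homOf j) ≫ μ[T.X],
    Nonempty (IsColimit (Cofork.ofπ ((homOf i ⊗ₘ homOf j) ≫ μ[T.X]) w))

variable [Preadditive K] [HasBinaryBiproducts K]

/-- Given homomorphisms `f : R ⟶ S` and `g : S ⟶ S'`, the `S`-algebra `S'` is the complement of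
`S` in `S ⊗_R S`: there is an isomorphism of `S`-algebras `h : S ⊗_R S ≅ S × S'` (where `S` acts on
the left factor of `S ⊗_R S`) whose first component is the multiplication `S ⊗_R S ⟶ S`. -/
def IsSplittingStep [BraidedCategory K] {R S S' : CommMon K} (f : R ⟶ S) (g : S ⟶ S') : Prop :=
  ∃ (T : CommMon K) (i j : S ⟶ T) (h : T ≅ prodRing S S'),
    IsRelTensor f f i j ∧
    i ≫ h.hom = prodLift (𝟙 S) g ∧
    ((homOf i ⊗ₘ homOf j) ≫ μ[T.X]) ≫ homOf (h.hom ≫ prodFst S S') = μ[S.X]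

/-- A splitting tower `A⁽⁰⁾ ⟶ A⁽¹⁾ ⟶ A⁽²⁾ ⟶ ⋯` of `A`: a sequence of tt-rings with `A⁽⁰⁾ = 𝟙` and
`A⁽¹⁾ = A` such that, for `n ≥ 1`, the `A⁽ⁿ⁾`-algebra `A⁽ⁿ⁺¹⁾` is the complement of `A⁽ⁿ⁾` in
`A⁽ⁿ⁾ ⊗_{A⁽ⁿ⁻¹⁾} A⁽ⁿ⁾`. -/
structure SplittingTower [BraidedCategory K] (A : CommMon K) where
  /-- The tt-rings `A⁽ⁿ⁾`. -/
  obj : ℕ → CommMon K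
  /-- The homomorphisms `A⁽ⁿ⁾ ⟶ A⁽ⁿ⁺¹⁾`. -/
  map (n : ℕ) : obj n ⟶ obj (n + 1)
  separable (n : ℕ) : IsSeparableRing (obj n).X
  /-- `A⁽⁰⁾` is `𝟙`. -/
  isoZero : obj 0 ≅ CommMon.trivial K
  /-- `A⁽¹⁾` is `A`. -/
  isoOne : obj 1 ≅ A
  step (n : ℕ) : IsSplittingStep (map n) (map (n + 1))

/-- `A` has finite degree `d` if `A⁽ᵈ⁾ ≠ 0` and `A⁽ᵈ⁺¹⁾ = 0`. -/
def HasDegree [BraidedCategory K] (A : CommMon K) (d : ℕ) : Prop :=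
  ∃ T : SplittingTower A, ¬ IsZero (T.obj d).X ∧ IsZero (T.obj (d + 1)).X

/-- The degree of `A`; it is `⊤` if `A` does not have finite degree. -/
def deg [BraidedCategory K] (A : CommMon K) : ℕ∞ :=
  ⨅ (d : ℕ) (_ : HasDegree A d), (d : ℕ∞)

end Tower

/-! ### The spectrum, supports and weakly conservative functors -/

section Spectrum

variable (K : Type u) [Category.{v} K] [Preadditive K] [HasZeroObject K] [HasShift K ℤ]
    [∀ n : ℤ, (shiftFunctor K n).Additive] [Pretriangulated K] [MonoidalCategory K]

/-- The spectrum of `K`: the prime thick `⊗`-ideals, i.e. the full triangulated subcategories `P`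
closed under direct summands and under tensoring with arbitrary objects, such that `P ≠ K`, and
such that `x ⊗ y ∈ P` implies `x ∈ P` or `y ∈ P`. -/
structure Spc where
  /-- The objects of the prime. -/
  carrier : ObjectProperty K
  isTriangulated : carrier.IsTriangulated
  thick : carrier.IsStableUnderRetracts
  ideal (x y : K) : carrier y → carrier (x ⊗ y)
  proper : ∃ x : K, ¬ carrier x
  prime (x y : K) : carrier (x ⊗ y) → carrier x ∨ carrier y

variable {K}

/-- The support of an object: the set of primes which do not contain it. -/
def supp (x : K) : Set (Spc K) := {P | ¬ P.carrier x}

/-- A functor `F` out of `K` is weakly conservative on `K_Z`, the subcategory of all objects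
supported on `Z`, if every `x` in it with `F(x) = 0` is `⊗`-nilpotent. -/
def IsWeaklyConservativeOn {L : Type u'} [Category.{v'} L] (F : K ⥤ L) (Z : Set (Spc K)) : Prop :=
  ∀ x : K, supp x ⊆ Z → IsZero (F.obj x) → IsTensorNilpotent x

end Spectrum

end TTDegree

open TTDegree

/-! Everything is read through homomorphisms of commutative ring objects, the functor of points. The
morphisms `𝟙 ⟶ C` form a commutative ring `Pt C`. Since `K` is idempotent complete, every idempotent
point `e` cuts out a direct factor of `C`, and this factor is universal for homomorphisms sending
`e` to `1` (`IsLoc`, `exists_isLoc`, `IsLoc.exists_lift`). An idempotent is therefore zero as soon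
as it becomes `1` only over the zero ring (`idem_eq_zero`), which makes arguments on points
possible.

Separability of `A` means that the multiplication `A ⊗ A ⟶ A` is such a direct factor. Hence for two
homomorphisms `x, y : A ⟶ D` there is an idempotent `eqPt` of `D` cutting out the locus where they
agree: it is `1` iff `x = y`, and `0` iff `x` and `y` are disjoint, that is, agree only over the
zero ring. The relative tensor product `S ⊗_R S` is likewise cut out of `S ⊗ S` by an idempotent,
and a splitting step removes the diagonal from it. It follows by induction (`IsConf.step`) that
`A⁽ⁿ⁾` represents `n`-tuples of pairwise disjoint homomorphisms out of `A`. So any two towers have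
isomorphic stages, and the degree does not depend on the tower.

Over `R = A⁽ⁿ⁾` the `n` universal points give orthogonal idempotents of `R ⊗ A`. Each of them cuts
out a copy of `R`, and the complement represents one further disjoint point, so it is `A⁽ⁿ⁺¹⁾`. This
is the decomposition of the extension of scalars.

If `A` is split by `d` points over a nonzero `B`, these points are a homomorphism `A⁽ᵈ⁾ ⟶ B`, so
`A⁽ᵈ⁾ ≠ 0`. By the pigeonhole principle (`IsSplit.isZero_of_lt`) there are no `d + 1` disjoint
points over a nonzero `B`-algebra, so `B ⊗ A⁽ᵈ⁺¹⁾ = 0`. The hypotheses on supports or locality then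
give `A⁽ᵈ⁺¹⁾ = 0`, because a ring that is `⊗`-nilpotent or has empty support is zero. A tt-functor
preserves tensor products and direct factors, so the same argument runs on the image of the tower.
-/

namespace TTDegree

set_option linter.unusedSectionVars false

/-! ### The ring of points of a commutative ring object -/

noncomputable section Points

variable {K : Type u} [Category.{v} K] [MonoidalCategory K]

/-- Multiplication by `e : 𝟙 ⟶ C` on a ring object `C`. -/
def pointMul {C : K} [MonObj C] (e : 𝟙_ K ⟶ C) : C ⟶ C := (λ_ C).inv ≫ (e ▷ C) ≫ μ

section

variable {C D : K} [MonObj C] [MonObj D]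

@[simp]
theorem pointMul_one : pointMul (η : 𝟙_ K ⟶ C) = 𝟙 C := by simp [pointMul]

@[simp]
theorem one_comp_pointMul (e : 𝟙_ K ⟶ C) : η ≫ pointMul e = e := by
  rw [pointMul, leftUnitor_inv_naturality_assoc, whisker_exchange_assoc, MonObj.mul_one,
    unitors_inv_equal]
  simp

theorem pointMul_comp (e e' : 𝟙_ K ⟶ C) :
    pointMul (e' ≫ pointMul e) = pointMul e' ≫ pointMul e := by
  have h : (pointMul e ▷ C) ≫ μ = μ ≫ pointMul e := by
    simp only [pointMul, comp_whiskerRight, Category.assoc, MonObj.mul_assoc]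
    rw [leftUnitor_inv_naturality_assoc, whisker_exchange_assoc]
    simp
  rw [pointMul, comp_whiskerRight, Category.assoc, h]
  simp [pointMul]

theorem pointMul_naturality (f : C ⟶ D) [IsMonHom f] (e : 𝟙_ K ⟶ C) :
    pointMul e ≫ f = f ≫ pointMul (e ≫ f) := by
  simp only [pointMul, Category.assoc, IsMonHom.mul_hom, comp_whiskerRight]
  rw [leftUnitor_inv_naturality_assoc, MonoidalCategory.tensorHom_def, Category.assoc]
  simp only [← whisker_exchange_assoc]

theorem comp_pointMul_comm [BraidedCategory K] [IsCommMonObj C] (e e' : 𝟙_ K ⟶ C) :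
    e' ≫ pointMul e = e ≫ pointMul e' := by
  have h (a b : 𝟙_ K ⟶ C) : b ≫ pointMul a = (λ_ (𝟙_ K)).inv ≫ (a ⊗ₘ b) ≫ μ := by
    rw [pointMul, leftUnitor_inv_naturality_assoc, whisker_exchange_assoc,
      MonoidalCategory.tensorHom_def, Category.assoc]
  rw [h, h]
  nth_rw 1 [← IsCommMonObj.mul_comm C]
  rw [BraidedCategory.braiding_naturality_assoc, ← Category.assoc]
  congr 1
  rw [Iso.inv_comp_eq, ← cancel_mono (λ_ (𝟙_ K)).hom]
  simp [unitors_equal]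

end

variable [Preadditive K] [MonoidalPreadditive K]

theorem pointMul_add {C : K} [MonObj C] (e e' : 𝟙_ K ⟶ C) :
    pointMul (e + e') = pointMul e + pointMul e' := by
  simp [pointMul]

@[simp]
theorem pointMul_zero {C : K} [MonObj C] : pointMul (0 : 𝟙_ K ⟶ C) = 0 := by
  simp [pointMul]

variable [BraidedCategory K]

/-- The points `𝟙 ⟶ C` of a commutative ring object. -/
def Pt (C : CommMon K) : Type v := 𝟙_ K ⟶ C.X

/-- The morphism underlying a point. -/
def Pt.toHom {C : CommMon K} (e : Pt C) : 𝟙_ K ⟶ C.X := e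

instance (C : CommMon K) : AddCommGroup (Pt C) :=
  inferInstanceAs (AddCommGroup (𝟙_ K ⟶ C.X))

/-- With this structure, identities between idempotents reduce to ordinary commutative algebra, and
`Pt.smul` turns them into identities between endomorphisms of `C`. -/
instance (C : CommMon K) : CommRing (Pt C) where
  __ := (inferInstance : AddCommGroup (Pt C))
  mul a b := b.toHom ≫ pointMul a.toHom
  one := (η : 𝟙_ K ⟶ C.X)
  left_distrib a b c := Preadditive.add_comp _ _ _ b.toHom c.toHom _
  right_distrib a b c :=
    (congrArg (c.toHom ≫ ·) (pointMul_add a.toHom b.toHom)).trans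
      (Preadditive.comp_add _ _ _ _ _ _)
  zero_mul a := (congrArg (a.toHom ≫ ·) pointMul_zero).trans comp_zero
  mul_zero a := zero_comp
  mul_assoc a b c :=
    (congrArg (c.toHom ≫ ·) (pointMul_comp a.toHom b.toHom)).trans (Category.assoc _ _ _).symm
  one_mul a := (congrArg (a.toHom ≫ ·) pointMul_one).trans (Category.comp_id _)
  mul_one a := one_comp_pointMul a.toHom
  mul_comm a b := comp_pointMul_comm a.toHom b.toHom

namespace Pt

variable {C D E : CommMon K}

/-- Functoriality of points. -/
def map (f : C ⟶ D) : Pt C →+* Pt D where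
  toFun e := e.toHom ≫ homOf f
  map_one' := IsMonHom.one_hom (homOf f)
  map_zero' := zero_comp
  map_add' a b := Preadditive.add_comp _ _ _ a.toHom b.toHom _
  map_mul' a b := by
    change (b.toHom ≫ pointMul a.toHom) ≫ homOf f =
      (b.toHom ≫ homOf f) ≫ pointMul (a.toHom ≫ homOf f)
    rw [Category.assoc, Category.assoc, pointMul_naturality]

theorem toHom_map (f : C ⟶ D) (e : Pt C) : (map f e).toHom = e.toHom ≫ homOf f := rfl

theorem map_comp (f : C ⟶ D) (g : D ⟶ E) (e : Pt C) : map (f ≫ g) e = map g (map f e) :=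
  (Category.assoc e.toHom _ _).symm

/-- Multiplication by a point. -/
def smul (e : Pt C) : C.X ⟶ C.X := pointMul e.toHom

@[simp]
theorem smul_one : smul (1 : Pt C) = 𝟙 C.X := pointMul_one

@[simp]
theorem smul_zero : smul (0 : Pt C) = 0 := pointMul_zero

theorem smul_add (a b : Pt C) : smul (a + b) = smul a + smul b := pointMul_add _ _

theorem smul_mul (a b : Pt C) : smul (a * b) = smul a ≫ smul b := by
  rw [mul_comm]
  exact pointMul_comp _ _

theorem smul_sum {J : Type*} (s : Finset J) (a : J → Pt C) :
    smul (∑ i ∈ s, a i) = ∑ i ∈ s, smul (a i) := by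
  classical
  induction s using Finset.induction_on with
  | empty => simp
  | insert i s hi ih => rw [Finset.sum_insert hi, Finset.sum_insert hi, smul_add, ih]

theorem smul_comp (f : C ⟶ D) (e : Pt C) : smul e ≫ homOf f = homOf f ≫ smul (map f e) :=
  pointMul_naturality _ _

theorem smul_comp_assoc (f : C ⟶ D) (e : Pt C) {X : K} (h : D.X ⟶ X) :
    smul e ≫ homOf f ≫ h = homOf f ≫ smul (map f e) ≫ h := by
  rw [← Category.assoc, smul_comp, Category.assoc]

theorem one_comp_smul (e : Pt C) : η ≫ smul e = e.toHom := one_comp_pointMul _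

end Pt

/-- Vanishing becomes an equation between points, so it propagates along every ring homomorphism. -/
theorem isZero_iff_one_eq_zero (C : CommMon K) : IsZero C.X ↔ (1 : Pt C) = 0 := by
  constructor
  · intro h
    exact h.eq_of_tgt _ _
  · intro h
    rw [IsZero.iff_id_eq_zero, ← Pt.smul_one, h, Pt.smul_zero]

theorem isZero_of_hom {C D : CommMon K} (f : C ⟶ D) (h : IsZero C.X) : IsZero D.X := by
  rw [isZero_iff_one_eq_zero] at *
  rw [← map_one (Pt.map f), h, map_zero]

end Points

/-! ### Coproducts of commutative ring objects -/

noncomputable section Coproducts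

variable {K : Type u} [Category.{v} K] [MonoidalCategory K] [SymmetricCategory K]

instance isMonHom_mul (D : K) [MonObj D] [IsCommMonObj D] : IsMonHom (μ : D ⊗ D ⟶ D) where
  one_hom := by
    rw [MonObj.tensorObj.one_def, Category.assoc, MonObj.one_mul_hom, Iso.inv_hom_id_assoc]
  mul_hom := by simp [MonObj.tensorObj.mul_def]

/-- The coproduct `C ⊗ D` of commutative ring objects. -/
abbrev tensorRing (C D : CommMon K) : CommMon K := ⟨C.X ⊗ D.X⟩

/-- The homomorphism `d ↦ 1 ⊗ d` from `D` to `C ⊗ D`. -/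
abbrev inclRight (C D : CommMon K) : D ⟶ tensorRing C D :=
  ringHom ((λ_ D.X).inv ≫ (η[C.X] ▷ D.X))

/-- The homomorphism `c ⊗ d ↦ f c * g d`. -/
abbrev tensorDesc {C D E : CommMon K} (f : C ⟶ E) (g : D ⟶ E) : tensorRing C D ⟶ E :=
  ringHom ((homOf f ⊗ₘ homOf g) ≫ μ)

/-- The multiplication `C ⊗ C ⟶ C`. -/
abbrev codiag (C : CommMon K) : tensorRing C C ⟶ C := tensorDesc (𝟙 C) (𝟙 C)

variable {C D E E' : CommMon K}

theorem homOf_codiag (C : CommMon K) : homOf (codiag C) = μ := by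
  change (𝟙 C.X ⊗ₘ 𝟙 C.X) ≫ μ = μ
  simp

@[simp]
theorem inclLeft_desc (f : C ⟶ E) (g : D ⟶ E) : inclLeft C D ≫ tensorDesc f g = f := by
  ext
  change ((ρ_ C.X).inv ≫ (C.X ◁ η)) ≫ (homOf f ⊗ₘ homOf g) ≫ μ = homOf f
  rw [MonoidalCategory.tensorHom_def', Category.assoc, Category.assoc,
    ← MonoidalCategory.whiskerLeft_comp_assoc, IsMonHom.one_hom, whisker_exchange_assoc,
    MonObj.mul_one]
  simp

@[simp]
theorem inclLeft_desc_assoc (f : C ⟶ E) (g : D ⟶ E) {X : CommMon K} (h : E ⟶ X) :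
    inclLeft C D ≫ tensorDesc f g ≫ h = f ≫ h := by
  rw [← Category.assoc, inclLeft_desc]

@[simp]
theorem inclRight_desc (f : C ⟶ E) (g : D ⟶ E) : inclRight C D ≫ tensorDesc f g = g := by
  ext
  change ((λ_ D.X).inv ≫ (η ▷ D.X)) ≫ (homOf f ⊗ₘ homOf g) ≫ μ = homOf g
  rw [MonoidalCategory.tensorHom_def, Category.assoc, Category.assoc,
    ← MonoidalCategory.comp_whiskerRight_assoc, IsMonHom.one_hom, ← whisker_exchange_assoc,
    MonObj.one_mul]
  simp

@[simp]
theorem inclRight_desc_assoc (f : C ⟶ E) (g : D ⟶ E) {X : CommMon K} (h : E ⟶ X) :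
    inclRight C D ≫ tensorDesc f g ≫ h = g ≫ h := by
  rw [← Category.assoc, inclRight_desc]

/-- This is the formula `(c ⊗ 1)(1 ⊗ d) = c ⊗ d`. It is what makes `C ⊗ D` the coproduct: a
homomorphism out of it is the product of its two restrictions. -/
theorem incl_tensor_mul (C D : CommMon K) :
    (homOf (inclLeft C D) ⊗ₘ homOf (inclRight C D)) ≫ μ[C.X ⊗ D.X] = 𝟙 (C.X ⊗ D.X) := by
  change (((ρ_ C.X).inv ≫ (C.X ◁ η)) ⊗ₘ ((λ_ D.X).inv ≫ (η ▷ D.X))) ≫ μ[C.X ⊗ D.X] = _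
  rw [MonObj.tensorObj.mul_def, ← tensorHom_comp_tensorHom, Category.assoc, ← id_tensorHom,
    ← tensorHom_id, tensorμ_natural_assoc, tensorHom_comp_tensorHom]
  simp only [id_tensorHom, tensorHom_id, MonObj.mul_one, MonObj.one_mul]
  rw [tensorμ, braiding_tensorUnit_left]
  monoidal

theorem tensor_hom_ext {f g : tensorRing C D ⟶ E} (h₁ : inclLeft C D ≫ f = inclLeft C D ≫ g)
    (h₂ : inclRight C D ≫ f = inclRight C D ≫ g) : f = g := by
  have key (f : tensorRing C D ⟶ E) :
      homOf f = (homOf (inclLeft C D ≫ f) ⊗ₘ homOf (inclRight C D ≫ f)) ≫ μ := by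
    change _ = ((homOf (inclLeft C D) ≫ homOf f) ⊗ₘ (homOf (inclRight C D) ≫ homOf f)) ≫ μ
    rw [← tensorHom_comp_tensorHom, Category.assoc, ← IsMonHom.mul_hom (homOf f),
      ← Category.assoc, incl_tensor_mul, Category.id_comp]
  ext
  change homOf f = homOf g
  rw [key f, key g, h₁, h₂]

theorem tensorDesc_comp (f : C ⟶ E) (g : D ⟶ E) (h : E ⟶ E') :
    tensorDesc f g ≫ h = tensorDesc (f ≫ h) (g ≫ h) :=
  tensor_hom_ext (by simp) (by simp)

theorem tensorDesc_eta (h : tensorRing C D ⟶ E) :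
    tensorDesc (inclLeft C D ≫ h) (inclRight C D ≫ h) = h :=
  tensor_hom_ext (by simp) (by simp)

theorem codiag_comp (h : C ⟶ E) : codiag C ≫ h = tensorDesc h h := by simp [tensorDesc_comp]

end Coproducts

/-! ### Localization at idempotent points -/

noncomputable section Localization

variable {K : Type u} [Category.{v} K] [MonoidalCategory K] [Preadditive K]
  [MonoidalPreadditive K] [BraidedCategory K] {C D E : CommMon K}

/-- An isomorphism of ring objects from a homomorphism with an inverse in `K`. -/
theorem exists_iso_of_inverse (f : C ⟶ D) (g : D.X ⟶ C.X) (h₁ : homOf f ≫ g = 𝟙 _)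
    (h₂ : g ≫ homOf f = 𝟙 _) : ∃ φ : C ≅ D, φ.hom = f := by
  let φ : C.X ≅ D.X := ⟨homOf f, g, h₁, h₂⟩
  have : IsMonHom φ.hom := isMonHom_homOf f
  exact ⟨CommMon.mkIso' φ, rfl⟩

/-- `p : C ⟶ D` exhibits `D` as the direct factor of `C` cut out by the idempotent point `e`. -/
def IsLoc (p : C ⟶ D) (e : Pt C) : Prop :=
  ∃ s : D.X ⟶ C.X, s ≫ homOf p = 𝟙 _ ∧ homOf p ≫ s = e.smul

namespace IsLoc

variable {p : C ⟶ D} {e : Pt C}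

theorem map_eq_one (h : IsLoc p e) : Pt.map p e = 1 := by
  obtain ⟨s, h₁, h₂⟩ := h
  change e.toHom ≫ homOf p = η
  rw [← Pt.one_comp_smul, ← h₂, Category.assoc, Category.assoc, h₁, Category.comp_id]
  exact IsMonHom.one_hom (homOf p)

theorem cancel (h : IsLoc p e) {X : K} {f g : D.X ⟶ X} (w : homOf p ≫ f = homOf p ≫ g) :
    f = g := by
  obtain ⟨s, h₁, -⟩ := h
  rw [← Category.id_comp f, ← h₁, Category.assoc, w, reassoc_of% h₁]

theorem hom_ext (h : IsLoc p e) {f g : D ⟶ E} (w : p ≫ f = p ≫ g) : f = g := by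
  ext
  exact h.cancel (congrArg homOf w)

theorem exists_lift (h : IsLoc p e) (f : C ⟶ E) (hf : Pt.map f e = 1) : ∃ g : D ⟶ E, p ≫ g = f := by
  have h' := h
  obtain ⟨s, h₁, h₂⟩ := h
  have hs : homOf p ≫ s ≫ homOf f = homOf f := by
    rw [reassoc_of% h₂, Pt.smul_comp, hf, Pt.smul_one, Category.comp_id]
  have hpp : (s ⊗ₘ s) ≫ (homOf p ⊗ₘ homOf p) = 𝟙 _ := by
    rw [tensorHom_comp_tensorHom, h₁, id_tensorHom_id]
  have : IsMonHom (s ≫ homOf f) :=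
    { one_hom := by
        rw [← IsMonHom.one_hom (homOf p), Category.assoc, hs, IsMonHom.one_hom (homOf f)]
      mul_hom := by
        rw [← Category.id_comp (μ ≫ s ≫ homOf f), ← hpp, Category.assoc,
          ← IsMonHom.mul_hom_assoc (homOf p), hs, IsMonHom.mul_hom (homOf f),
          tensorHom_comp_tensorHom_assoc] }
  refine ⟨CommMon.homMk (Mon.Hom.mk' (s ≫ homOf f) this.one_hom this.mul_hom), ?_⟩
  ext
  exact hs

/-- A factor of a localization is a localization. -/
theorem of_comp {q : D ⟶ E} {e' : Pt C} (h : IsLoc p e) (h' : IsLoc (p ≫ q) e') :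
    IsLoc q (Pt.map p e') := by
  obtain ⟨s, h₁, h₂⟩ := h'
  refine ⟨s ≫ homOf p, by rw [Category.assoc]; exact h₁, h.cancel ?_⟩
  have h₂' : homOf p ≫ homOf q ≫ s = e'.smul := by rw [← h₂]; exact (Category.assoc _ _ _).symm
  rw [reassoc_of% h₂', Pt.smul_comp]

theorem comp_iso (h : IsLoc p e) (φ : D ≅ E) : IsLoc (p ≫ φ.hom) e := by
  obtain ⟨s, h₁, h₂⟩ := h
  have w₁ : homOf φ.hom ≫ homOf φ.inv = 𝟙 _ := congrArg homOf φ.hom_inv_id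
  have w₂ : homOf φ.inv ≫ homOf φ.hom = 𝟙 _ := congrArg homOf φ.inv_hom_id
  refine ⟨homOf φ.inv ≫ s, ?_, ?_⟩
  · change (homOf φ.inv ≫ s) ≫ homOf p ≫ homOf φ.hom = 𝟙 _
    rw [Category.assoc, reassoc_of% h₁, w₂]
  · change (homOf p ≫ homOf φ.hom) ≫ homOf φ.inv ≫ s = _
    rw [Category.assoc, reassoc_of% w₁, h₂]

theorem idem (h : IsLoc p e) : e * e = e := by
  change e.toHom ≫ e.smul = e.toHom
  obtain ⟨s, h₁, h₂⟩ := h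
  rw [← Pt.one_comp_smul, ← h₂]
  simp [reassoc_of% h₁]

end IsLoc

theorem smul_whiskerRight_mul (a : Pt C) : (a.smul ▷ C.X) ≫ μ = μ ≫ a.smul := by
  simp only [Pt.smul, pointMul, comp_whiskerRight, Category.assoc, MonObj.mul_assoc]
  rw [leftUnitor_inv_naturality_assoc, whisker_exchange_assoc]
  simp

theorem smul_whiskerRight_mul_assoc (a : Pt C) {X : K} (h : C.X ⟶ X) :
    (a.smul ▷ C.X) ≫ μ ≫ h = μ ≫ a.smul ≫ h := by
  rw [← Category.assoc, smul_whiskerRight_mul, Category.assoc]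

theorem whiskerLeft_smul_mul (a : Pt C) : (C.X ◁ a.smul) ≫ μ = μ ≫ a.smul := by
  rw [← IsCommMonObj.mul_comm C.X, BraidedCategory.braiding_naturality_right_assoc,
    smul_whiskerRight_mul, Category.assoc]

theorem mul_comp_smul (e : Pt C) (he : e * e = e) :
    μ ≫ e.smul = (e.smul ⊗ₘ e.smul) ≫ μ := by
  rw [MonoidalCategory.tensorHom_def, Category.assoc, whiskerLeft_smul_mul,
    smul_whiskerRight_mul_assoc, ← Pt.smul_mul, he]

/-- Multiplication by `e` is an idempotent endomorphism and splits. The ring structure descends to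
the image because this endomorphism is multiplicative, and the ring axioms are checked after
precomposing with tensor products of the split epimorphism `r`. -/
theorem exists_isLoc [IsIdempotentComplete K] (e : Pt C) (he : e * e = e) :
    ∃ (D : CommMon K) (p : C ⟶ D), IsLoc p e := by
  obtain ⟨Y, i, r, h₁, h₂⟩ := IsIdempotentComplete.idempotents_split C.X e.smul
    (by rw [← Pt.smul_mul, he])
  have hm : (r ⊗ₘ r) ≫ (i ⊗ₘ i) ≫ μ ≫ r = μ ≫ r := by
    rw [tensorHom_comp_tensorHom_assoc, h₂, ← reassoc_of% (mul_comp_smul e he), ← h₂,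
      Category.assoc, h₁, Category.comp_id]
  have : IsSplitEpi r := IsSplitEpi.mk' ⟨i, h₁⟩
  have hl (X : K) : (X ◁ i) ≫ (X ◁ r) = 𝟙 _ := by
    rw [← MonoidalCategory.whiskerLeft_comp, h₁, MonoidalCategory.whiskerLeft_id]
  have hr (X : K) : (i ▷ X) ≫ (r ▷ X) = 𝟙 _ := by
    rw [← comp_whiskerRight, h₁, id_whiskerRight]
  have (X : K) : IsSplitEpi (X ◁ r) := IsSplitEpi.mk' ⟨X ◁ i, hl X⟩
  have (X : K) : IsSplitEpi (r ▷ X) := IsSplitEpi.mk' ⟨i ▷ X, hr X⟩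
  obtain ⟨m, hm⟩ : ∃ m : Y ⊗ Y ⟶ Y, (r ⊗ₘ r) ≫ m = μ ≫ r := ⟨_, hm⟩
  have hm₁ : (C.X ◁ r) ≫ (r ▷ Y) ≫ m = μ ≫ r := by
    rw [← hm, MonoidalCategory.tensorHom_def', Category.assoc]
  have hm₂ : (r ▷ C.X) ≫ (Y ◁ r) ≫ m = μ ≫ r := by
    rw [← hm, MonoidalCategory.tensorHom_def, Category.assoc]
  let M : MonObj Y :=
    { one := η ≫ r
      mul := m
      one_mul := by
        rw [← cancel_epi (𝟙_ K ◁ r), comp_whiskerRight_assoc, whisker_exchange_assoc, hm₁,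
          MonObj.one_mul_assoc, leftUnitor_naturality]
      mul_one := by
        rw [← cancel_epi (r ▷ 𝟙_ K), MonoidalCategory.whiskerLeft_comp_assoc,
          ← whisker_exchange_assoc, hm₂, MonObj.mul_one_assoc, rightUnitor_naturality]
      mul_assoc := by
        have e₁ : ((r ⊗ₘ r) ⊗ₘ r) ≫ (m ▷ Y) = (μ ▷ C.X) ≫ (r ⊗ₘ r) := by
          rw [← tensorHom_id, tensorHom_comp_tensorHom, hm, ← tensorHom_id,
            tensorHom_comp_tensorHom, Category.comp_id, Category.id_comp]
        have e₂ : (r ⊗ₘ (r ⊗ₘ r)) ≫ (Y ◁ m) = (C.X ◁ μ) ≫ (r ⊗ₘ r) := by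
          rw [← id_tensorHom, tensorHom_comp_tensorHom, hm, ← id_tensorHom,
            tensorHom_comp_tensorHom, Category.comp_id, Category.id_comp]
        have : IsSplitEpi ((r ⊗ₘ r) ⊗ₘ r) := IsSplitEpi.mk' ⟨(i ⊗ₘ i) ⊗ₘ i, by
          simp only [tensorHom_comp_tensorHom, h₁, id_tensorHom_id]⟩
        rw [← cancel_epi ((r ⊗ₘ r) ⊗ₘ r), reassoc_of% e₁, hm, associator_naturality_assoc,
          reassoc_of% e₂, hm, MonObj.mul_assoc_assoc] }
  have hM : IsMonHom r := ⟨rfl, hm.symm⟩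
  have : IsCommMonObj Y := ⟨by
    have : IsSplitEpi (r ⊗ₘ r) := IsSplitEpi.mk' ⟨i ⊗ₘ i, by
      rw [tensorHom_comp_tensorHom, h₁, id_tensorHom_id]⟩
    change (β_ Y Y).hom ≫ m = m
    rw [← cancel_epi (r ⊗ₘ r), BraidedCategory.braiding_naturality_assoc, hm,
      IsCommMonObj.mul_comm_assoc]⟩
  exact ⟨⟨Y⟩, ringHom r, i, h₁, h₂⟩

/-- The direct factor cut out by `e` has the same universal property, so it is isomorphic to `D`
under `C`. Direct factors can thus be recognized on points alone. -/
theorem IsLoc.of_universal [IsIdempotentComplete K] {p : C ⟶ D} {e : Pt C} (he : e * e = e)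
    (hp : Pt.map p e = 1)
    (h : ∀ {E : CommMon K} (f : C ⟶ E), Pt.map f e = 1 → ∃ g : D ⟶ E, p ≫ g = f)
    (h' : ∀ f : D ⟶ D, p ≫ f = p → f = 𝟙 D) : IsLoc p e := by
  obtain ⟨Q, q, hq⟩ := exists_isLoc e he
  obtain ⟨φ, hφ⟩ := h q hq.map_eq_one
  obtain ⟨ψ, hψ⟩ := hq.exists_lift p hp
  have w₁ : φ ≫ ψ = 𝟙 D := h' _ (by rw [reassoc_of% hφ, hψ])
  have w₂ : ψ ≫ φ = 𝟙 Q := hq.hom_ext (by rw [reassoc_of% hψ, hφ, Category.comp_id])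
  rw [← hψ]
  exact hq.comp_iso ⟨ψ, φ, w₂, w₁⟩

/-- Apply the hypothesis to the direct factor cut out by `e`, over which `e` becomes `1`. -/
theorem idem_eq_zero [IsIdempotentComplete K] {e : Pt C} (he : e * e = e)
    (h : ∀ {D : CommMon K} (p : C ⟶ D), Pt.map p e = 1 → IsZero D.X) : e = 0 := by
  obtain ⟨D, p, s, h₁, h₂⟩ := exists_isLoc e he
  have hD := h p (IsLoc.map_eq_one ⟨s, h₁, h₂⟩)
  change e.toHom = 0
  rw [← Pt.one_comp_smul, ← h₂, hD.eq_of_tgt (homOf p) 0, zero_comp, comp_zero]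

theorem idem_mul_eq [IsIdempotentComplete K] {e e' : Pt C} (he : e * e = e)
    (h : ∀ {D : CommMon K} (p : C ⟶ D), Pt.map p e = 1 → Pt.map p e' = 1) : e' * e = e := by
  obtain ⟨D, p, s, h₁, h₂⟩ := exists_isLoc e he
  have hD := h p (IsLoc.map_eq_one ⟨s, h₁, h₂⟩)
  change e.toHom ≫ e'.smul = e.toHom
  have hs : e.smul ≫ e'.smul = e.smul := by
    rw [← Pt.smul_mul, mul_comm, Pt.smul_mul, ← h₂, ← Category.assoc, Pt.smul_comp, hD,
      Pt.smul_one, Category.comp_id]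
  rw [← Pt.one_comp_smul, Category.assoc, hs]

/-! ### Products -/

section

variable [HasBinaryBiproducts K]

/-- Orthogonality is automatic: `p` sends both `e` and `e + e'` to `1`, hence kills `e'`, and
symmetrically for `q`. The two sections then assemble to an inverse. -/
theorem exists_iso_prodLift {p : C ⟶ D} {q : C ⟶ E} {e e' : Pt C} (hp : IsLoc p e)
    (hq : IsLoc q e') (h : e + e' = 1) : ∃ φ : C ≅ prodRing D E, φ.hom = prodLift p q := by
  have h₁ : Pt.map p e' = 0 := by
    have := congrArg (Pt.map p) h
    rwa [map_add, hp.map_eq_one, map_one, add_eq_left] at this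
  have h₂ : Pt.map q e = 0 := by
    have := congrArg (Pt.map q) h
    rwa [map_add, hq.map_eq_one, map_one, add_eq_right] at this
  have hp' := hp
  have hq' := hq
  obtain ⟨s, s₁, s₂⟩ := hp
  obtain ⟨t, t₁, t₂⟩ := hq
  have hst : s ≫ homOf q = 0 := hp'.cancel (by
    rw [reassoc_of% s₂, Pt.smul_comp, h₂, Pt.smul_zero, comp_zero, comp_zero])
  have hts : t ≫ homOf p = 0 := hq'.cancel (by
    rw [reassoc_of% t₂, Pt.smul_comp, h₁, Pt.smul_zero, comp_zero, comp_zero])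
  refine exists_iso_of_inverse _ (biprod.desc s t) ?_ ?_
  · change biprod.lift (homOf p) (homOf q) ≫ biprod.desc s t = 𝟙 _
    rw [biprod.lift_desc, s₂, t₂, ← Pt.smul_add, h, Pt.smul_one]
  · change biprod.desc s t ≫ biprod.lift (homOf p) (homOf q) = 𝟙 _
    ext <;> simp [s₁, t₁, hst, hts]

/-- The idempotent `(1, 0)` of `C × D`. -/
def fstPt (C D : CommMon K) : Pt (prodRing C D) := (η[C.X] ≫ biprod.inl : 𝟙_ K ⟶ C.X ⊞ D.X)

/-- The idempotent `(0, 1)` of `C × D`. -/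
def sndPt (C D : CommMon K) : Pt (prodRing C D) := (η[D.X] ≫ biprod.inr : 𝟙_ K ⟶ C.X ⊞ D.X)

theorem map_fst_fstPt (C D : CommMon K) : Pt.map (prodFst C D) (fstPt C D) = 1 := by
  change (η[C.X] ≫ biprod.inl) ≫ biprod.fst = η[C.X]
  simp

theorem map_snd_fstPt (C D : CommMon K) : Pt.map (prodSnd C D) (fstPt C D) = 0 := by
  change (η[C.X] ≫ biprod.inl) ≫ biprod.snd = 0
  simp

theorem map_fst_sndPt (C D : CommMon K) : Pt.map (prodFst C D) (sndPt C D) = 0 := by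
  change (η[D.X] ≫ biprod.inr) ≫ biprod.fst = 0
  simp

theorem map_snd_sndPt (C D : CommMon K) : Pt.map (prodSnd C D) (sndPt C D) = 1 := by
  change (η[D.X] ≫ biprod.inr) ≫ biprod.snd = η[D.X]
  simp

theorem fstPt_add_sndPt (C D : CommMon K) : fstPt C D + sndPt C D = 1 := by
  apply biprod.hom_ext
  · change Pt.map (prodFst C D) (fstPt C D + sndPt C D) = Pt.map (prodFst C D) 1
    rw [map_add, map_fst_fstPt, map_fst_sndPt, add_zero, map_one]
  · change Pt.map (prodSnd C D) (fstPt C D + sndPt C D) = Pt.map (prodSnd C D) 1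
    rw [map_add, map_snd_fstPt, map_snd_sndPt, zero_add, map_one]

theorem isLoc_prodFst (C D : CommMon K) : IsLoc (prodFst C D) (fstPt C D) := by
  refine ⟨biprod.inl, biprod.inl_fst, ?_⟩
  change biprod.fst ≫ biprod.inl = _
  apply biprod.hom_ext
  · refine Eq.trans ?_ (Pt.smul_comp (prodFst C D) _).symm
    rw [map_fst_fstPt, Pt.smul_one]
    simp
    rfl
  · refine Eq.trans ?_ (Pt.smul_comp (prodSnd C D) _).symm
    rw [map_snd_fstPt]
    simp

theorem isLoc_prodSnd (C D : CommMon K) : IsLoc (prodSnd C D) (sndPt C D) := by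
  refine ⟨biprod.inr, biprod.inr_snd, ?_⟩
  change biprod.snd ≫ biprod.inr = _
  apply biprod.hom_ext
  · refine Eq.trans ?_ (Pt.smul_comp (prodFst C D) _).symm
    rw [map_fst_sndPt]
    simp
  · refine Eq.trans ?_ (Pt.smul_comp (prodSnd C D) _).symm
    rw [map_snd_sndPt, Pt.smul_one]
    simp
    rfl

theorem prodLift_fst (f : C ⟶ D) (g : C ⟶ E) : prodLift f g ≫ prodFst D E = f := by
  ext
  exact biprod.lift_fst _ _

theorem prodLift_snd (f : C ⟶ D) (g : C ⟶ E) : prodLift f g ≫ prodSnd D E = g := by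
  ext
  exact biprod.lift_snd _ _

theorem comp_prodLift {B : CommMon K} (h : B ⟶ C) (f : C ⟶ D) (g : C ⟶ E) :
    h ≫ prodLift f g = prodLift (h ≫ f) (h ≫ g) := by
  ext
  change homOf h ≫ biprod.lift (homOf f) (homOf g) =
    biprod.lift (homOf h ≫ homOf f) (homOf h ≫ homOf g)
  ext <;> simp

end

section

variable [HasFiniteBiproducts K] {n : ℕ}

instance isMonHom_biproductπ (A : Fin n → K) [∀ i, MonObj (A i)] (i : Fin n) :
    IsMonHom (biproduct.π A i) where

/-- The projections of the `n`-fold product. -/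
abbrev powProj (C : CommMon K) (n : ℕ) (i : Fin n) : powRing C n ⟶ C :=
  ringHom (biproduct.π (fun _ : Fin n => C.X) i)

/-- The homomorphism into the `n`-fold product with given components. -/
abbrev powLift (f : Fin n → (C ⟶ D)) : C ⟶ powRing D n :=
  ringHom (biproduct.lift fun i => homOf (f i))

@[simp]
theorem powLift_proj (f : Fin n → (C ⟶ D)) (i : Fin n) : powLift f ≫ powProj D n i = f i := by
  ext
  exact biproduct.lift_π _ _

@[simp]
theorem powDiag_proj (i : Fin n) : powDiag C n ≫ powProj C n i = 𝟙 C := by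
  ext
  exact biproduct.lift_π _ _

@[simp]
theorem powDiag_proj_assoc (i : Fin n) {X : CommMon K} (h : C ⟶ X) :
    powDiag C n ≫ powProj C n i ≫ h = h := by
  rw [← Category.assoc, powDiag_proj, Category.id_comp]

theorem pow_hom_ext {f g : C ⟶ powRing D n}
    (h : ∀ i, f ≫ powProj D n i = g ≫ powProj D n i) : f = g := by
  ext
  exact biproduct.hom_ext _ _ fun i => congrArg homOf (h i)

/-- The standard idempotents of the `n`-fold product. -/
def powPt (C : CommMon K) (n : ℕ) (i : Fin n) : Pt (powRing C n) :=
  (η[C.X] ≫ biproduct.ι (fun _ : Fin n => C.X) i : 𝟙_ K ⟶ ⨁ fun _ : Fin n => C.X)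

theorem map_proj_powPt (i j : Fin n) :
    Pt.map (powProj C n j) (powPt C n i) = if i = j then 1 else 0 := by
  change (η[C.X] ≫ biproduct.ι (fun _ : Fin n => C.X) i) ≫ biproduct.π _ j = _
  split_ifs with h
  · subst h
    simp
    rfl
  · rw [Category.assoc, biproduct.ι_π_ne _ h, comp_zero]
    rfl

theorem pow_pt_ext {a b : Pt (powRing C n)}
    (h : ∀ i, Pt.map (powProj C n i) a = Pt.map (powProj C n i) b) : a = b :=
  biproduct.hom_ext _ _ h

theorem sum_powPt (C : CommMon K) (n : ℕ) : ∑ i, powPt C n i = 1 := by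
  refine pow_pt_ext fun j => ?_
  simp [map_proj_powPt]

theorem powPt_mul (i j : Fin n) : powPt C n i * powPt C n j = if i = j then powPt C n i else 0 := by
  refine pow_pt_ext fun k => ?_
  rw [map_mul, map_proj_powPt, map_proj_powPt]
  split_ifs <;> simp_all [map_proj_powPt]

theorem isLoc_powProj (i : Fin n) : IsLoc (powProj C n i) (powPt C n i) := by
  refine ⟨biproduct.ι (fun _ : Fin n => C.X) i, biproduct.ι_π_self _ _, ?_⟩
  change biproduct.π (fun _ : Fin n => C.X) i ≫ biproduct.ι (fun _ : Fin n => C.X) i = _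
  refine biproduct.hom_ext _ _ fun j => ?_
  refine Eq.trans ?_ (Pt.smul_comp (powProj C n j) _).symm
  rw [map_proj_powPt]
  split_ifs with h
  · subst h
    simp
    rfl
  · simp [biproduct.ι_π_ne _ h]

theorem isLoc_powLift {p : Fin n → (C ⟶ D)} {e : Fin n → Pt C} (hp : ∀ i, IsLoc (p i) (e i))
    (he : ∀ i j, i ≠ j → e i * e j = 0) : IsLoc (powLift p) (∑ i, e i) := by
  choose s h₁ h₂ using hp
  have hs (i j : Fin n) (hij : i ≠ j) : s i ≫ homOf (p j) = 0 := by
    have hj : IsLoc (p j) (e j) := ⟨s j, h₁ j, h₂ j⟩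
    have hi : IsLoc (p i) (e i) := ⟨s i, h₁ i, h₂ i⟩
    refine hi.cancel ?_
    have : Pt.map (p j) (e i) = 0 := by
      rw [← mul_one (Pt.map (p j) (e i)), ← hj.map_eq_one, ← map_mul, he i j hij, map_zero]
    rw [reassoc_of% (h₂ i), Pt.smul_comp, this, Pt.smul_zero, comp_zero, comp_zero]
  refine ⟨biproduct.desc s, ?_, ?_⟩
  · change biproduct.desc s ≫ biproduct.lift (fun i => homOf (p i)) = 𝟙 _
    refine biproduct.hom_ext _ _ fun j => biproduct.hom_ext' _ _ fun i => ?_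
    by_cases hij : i = j
    · subst hij
      simp [h₁]
    · simp [hs i j hij, biproduct.ι_π_ne _ hij]
  · change biproduct.lift (fun i => homOf (p i)) ≫ biproduct.desc s = _
    rw [biproduct.lift_desc, Pt.smul_sum]
    exact Finset.sum_congr rfl fun i _ => h₂ i

end

end Localization

noncomputable section Separable

variable {K : Type u} [Category.{v} K] [MonoidalCategory K] [Preadditive K]
  [MonoidalPreadditive K] [SymmetricCategory K] {A B C D E : CommMon K}

/-! ### Separability and disjoint points -/

/-- `A` is a direct factor of `A ⊗ A` by means of its multiplication. -/
def IsSep (A : CommMon K) : Prop := ∃ e : Pt (tensorRing A A), IsLoc (codiag A) e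

/-- The left action of `A` on `A ⊗ B` is multiplication by `a ⊗ 1`. With its mirror image below,
this translates the bimodule conditions on a section into the ring `A ⊗ A`. -/
theorem inclLeft_whiskerRight_mul (A B : CommMon K) :
    (homOf (inclLeft A B) ▷ (A.X ⊗ B.X)) ≫ μ[A.X ⊗ B.X] =
      (α_ A.X A.X B.X).inv ≫ (μ[A.X] ▷ B.X) := by
  change (((ρ_ A.X).inv ≫ (A.X ◁ η)) ▷ (A.X ⊗ B.X)) ≫ μ[A.X ⊗ B.X] = _
  rw [MonObj.tensorObj.mul_def, comp_whiskerRight_assoc, ← id_tensorHom A.X η, ← tensorHom_id,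
    ← tensorHom_id, ← id_tensorHom_id, tensorμ_natural_assoc, tensorHom_comp_tensorHom]
  simp only [tensorHom_id, id_whiskerRight, Category.id_comp, MonObj.one_mul]
  rw [tensorμ, braiding_tensorUnit_left]
  monoidal

theorem whiskerLeft_inclRight_mul (A B : CommMon K) :
    ((A.X ⊗ B.X) ◁ homOf (inclRight A B)) ≫ μ[A.X ⊗ B.X] =
      (α_ A.X B.X B.X).hom ≫ (A.X ◁ μ[B.X]) := by
  change ((A.X ⊗ B.X) ◁ ((λ_ B.X).inv ≫ (η ▷ B.X))) ≫ μ[A.X ⊗ B.X] = _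
  rw [MonObj.tensorObj.mul_def, MonoidalCategory.whiskerLeft_comp_assoc, ← tensorHom_id η,
    ← id_tensorHom, ← id_tensorHom,
    ← id_tensorHom_id, tensorμ_natural_assoc, tensorHom_comp_tensorHom]
  simp only [id_tensorHom, tensorHom_id, id_whiskerRight, Category.id_comp, MonObj.mul_one]
  rw [tensorμ, braiding_tensorUnit_right]
  monoidal

theorem smul_eq_mul_section {σ : A.X ⟶ A.X ⊗ A.X} {e : Pt (tensorRing A A)}
    (hl : σ = homOf (inclLeft A A) ≫ e.smul) :
    (σ ▷ A.X) ≫ ((A.X ⊗ A.X) ◁ homOf (inclRight A A)) ≫ μ = e.smul := by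
  have h := incl_tensor_mul A A
  rw [MonoidalCategory.tensorHom_def, Category.assoc] at h
  rw [hl, comp_whiskerRight_assoc, ← whisker_exchange_assoc, smul_whiskerRight_mul,
    reassoc_of% h]

theorem smul_eq_mul_section' {σ : A.X ⟶ A.X ⊗ A.X} {e : Pt (tensorRing A A)}
    (hr : σ = homOf (inclRight A A) ≫ e.smul) :
    (A.X ◁ σ) ≫ (homOf (inclLeft A A) ▷ (A.X ⊗ A.X)) ≫ μ = e.smul := by
  have h := incl_tensor_mul A A
  rw [MonoidalCategory.tensorHom_def', Category.assoc] at h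
  rw [hr, MonoidalCategory.whiskerLeft_comp_assoc, whisker_exchange_assoc, whiskerLeft_smul_mul,
    reassoc_of% h]

/-- The separability idempotent is `σ(1)`. Linearity gives `σ(a) = (1 ⊗ a) σ(1)`, so `μ ≫ σ` is
multiplication by `σ(1)`. -/
theorem IsSeparableRing.isSep (h : IsSeparableRing A.X) : IsSep A := by
  obtain ⟨σ, h₁, h₂, h₃⟩ := h.exists_section
  let e : Pt (tensorRing A A) := (η ≫ σ : 𝟙_ K ⟶ A.X ⊗ A.X)
  have he : e.toHom = η ≫ σ := rfl
  rw [← inclLeft_whiskerRight_mul] at h₂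
  rw [← whiskerLeft_inclRight_mul] at h₃
  have hr : σ = homOf (inclRight A A) ≫ e.smul := by
    rw [Pt.smul, pointMul, leftUnitor_inv_naturality_assoc, whisker_exchange_assoc, he,
      comp_whiskerRight_assoc, ← h₃, MonObj.one_mul_assoc, Iso.inv_hom_id_assoc]
  refine ⟨e, σ, ?_, ?_⟩
  · rw [homOf_codiag, h₁]
  · rw [homOf_codiag, h₂, smul_eq_mul_section' hr]

theorem IsSep.isSeparableRing (h : IsSep A) : IsSeparableRing A.X := by
  obtain ⟨e, s, h₁, h₂⟩ := h
  rw [homOf_codiag] at h₁ h₂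
  have hr : s = homOf (inclRight A A) ≫ e.smul := by
    have : homOf (inclRight A A) ≫ μ = 𝟙 _ := by
      rw [← homOf_codiag]
      exact congrArg homOf (inclRight_desc (𝟙 A) (𝟙 A))
    rw [← h₂, reassoc_of% this]
  have hl : s = homOf (inclLeft A A) ≫ e.smul := by
    have : homOf (inclLeft A A) ≫ μ = 𝟙 _ := by
      rw [← homOf_codiag]
      exact congrArg homOf (inclLeft_desc (𝟙 A) (𝟙 A))
    rw [← h₂, reassoc_of% this]
  refine ⟨s, h₁, ?_, ?_⟩
  · rw [h₂, ← inclLeft_whiskerRight_mul, smul_eq_mul_section' hr]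
  · rw [h₂, ← whiskerLeft_inclRight_mul, smul_eq_mul_section hl]

/-- Two homomorphisms `A ⟶ D` are disjoint if they agree only over the zero ring. -/
def Disj (x y : A ⟶ D) : Prop := ∀ {E : CommMon K} (g : D ⟶ E), x ≫ g = y ≫ g → IsZero E.X

theorem Disj.symm {x y : A ⟶ D} (h : Disj x y) : Disj y x := fun g hg => h g hg.symm

theorem Disj.comp {x y : A ⟶ D} (h : Disj x y) (f : D ⟶ E) : Disj (x ≫ f) (y ≫ f) :=
  fun g hg => h (f ≫ g) (by simpa using hg)

theorem Disj.of_precomp {x y : A ⟶ D} (f : B ⟶ A) (h : Disj (f ≫ x) (f ≫ y)) : Disj x y :=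
  fun g hg => h g (by rw [Category.assoc, Category.assoc, hg])

/-- The idempotent over which two homomorphisms `x, y : A ⟶ D` agree. -/
def eqPt (hA : IsSep A) (x y : A ⟶ D) : Pt D := Pt.map (tensorDesc x y) hA.choose

section

variable (hA : IsSep A) (x y : A ⟶ D)

theorem eqPt_idem : eqPt hA x y * eqPt hA x y = eqPt hA x y := by
  rw [eqPt, ← map_mul, hA.choose_spec.idem]

theorem map_eqPt (g : D ⟶ E) : Pt.map g (eqPt hA x y) = eqPt hA (x ≫ g) (y ≫ g) := by
  rw [eqPt, ← Pt.map_comp, tensorDesc_comp]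
  rfl

variable {x y}

theorem eqPt_eq_one_iff : eqPt hA x y = 1 ↔ x = y := by
  constructor
  · intro h
    obtain ⟨z, hz⟩ := hA.choose_spec.exists_lift _ h
    rw [codiag_comp] at hz
    rw [← inclLeft_desc x y, ← hz, inclLeft_desc, ← inclRight_desc x y, ← hz, inclRight_desc]
  · rintro rfl
    rw [eqPt, ← codiag_comp, Pt.map_comp, hA.choose_spec.map_eq_one, map_one]

variable [IsIdempotentComplete K]

/-- This turns disjointness, a quantification over all test rings, into an equation. Only in this
form can it be carried to another category. -/
theorem eqPt_eq_zero_iff : eqPt hA x y = 0 ↔ Disj x y := by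
  constructor
  · intro h E g hg
    rw [isZero_iff_one_eq_zero, ← (eqPt_eq_one_iff hA).2 hg, ← map_eqPt, h, map_zero]
  · intro h
    refine idem_eq_zero (eqPt_idem hA x y) fun p hp => h p ?_
    rwa [map_eqPt, eqPt_eq_one_iff] at hp

/-- A homomorphism out of `C ⊗ C` is a pair of points, and it factors through the multiplication iff
the two are equal. An idempotent detecting equality therefore has the universal property of the
diagonal. -/
theorem isSep_of_eq_iff {e : Pt (tensorRing C C)} (he : e * e = e)
    (h : ∀ {E : CommMon K} (x y : C ⟶ E), Pt.map (tensorDesc x y) e = 1 ↔ x = y) : IsSep C := by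
  refine ⟨e, IsLoc.of_universal he ((h _ _).2 rfl) (fun {E} f hf => ?_) fun f hf => ?_⟩
  · rw [← tensorDesc_eta f, h] at hf
    refine ⟨inclLeft C C ≫ f, ?_⟩
    rw [codiag_comp]
    conv_rhs => rw [← tensorDesc_eta f, ← hf]
  · have := congrArg (inclLeft C C ≫ ·) hf
    simpa using this

theorem IsSep.of_isLoc (hC : IsSep C) {p : C ⟶ D} {e : Pt C} (hp : IsLoc p e) : IsSep D := by
  refine isSep_of_eq_iff (eqPt_idem hC (p ≫ inclLeft D D) (p ≫ inclRight D D)) fun x y => ?_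
  rw [map_eqPt, eqPt_eq_one_iff, Category.assoc, Category.assoc, inclLeft_desc, inclRight_desc]
  exact ⟨hp.hom_ext, fun h => by rw [h]⟩

theorem mul_eq_one_iff_of_idem {a b : Pt C} (ha : a * a = a) (hb : b * b = b) :
    a * b = 1 ↔ a = 1 ∧ b = 1 := by
  constructor
  · intro h
    constructor
    · linear_combination h + b * ha - a * h
    · linear_combination h + a * hb - b * h
  · rintro ⟨rfl, rfl⟩
    exact one_mul 1

theorem IsSep.tensor (hC : IsSep C) (hD : IsSep D) : IsSep (tensorRing C D) := by
  let T : CommMon K := tensorRing C D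
  refine isSep_of_eq_iff (e := eqPt hC (inclLeft C D ≫ inclLeft T T) (inclLeft C D ≫ inclRight T T) *
    eqPt hD (inclRight C D ≫ inclLeft T T) (inclRight C D ≫ inclRight T T)) ?_ fun x y => ?_
  · rw [mul_mul_mul_comm, eqPt_idem, eqPt_idem]
  · rw [map_mul, map_eqPt, map_eqPt, mul_eq_one_iff_of_idem (eqPt_idem _ _ _) (eqPt_idem _ _ _),
      eqPt_eq_one_iff, eqPt_eq_one_iff, Category.assoc, Category.assoc, Category.assoc,
      Category.assoc, inclLeft_desc, inclRight_desc]
    exact ⟨fun h => tensor_hom_ext h.1 h.2, fun h => by rw [h]; exact ⟨rfl, rfl⟩⟩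

theorem isSep_trivial : IsSep (CommMon.trivial K) :=
  isSep_of_eq_iff (e := 1) (one_mul 1) fun _ _ =>
    ⟨fun _ => Subsingleton.elim _ _, fun _ => map_one _⟩

end

theorem powRing_trivial_hom_ext [HasFiniteBiproducts K] {n : ℕ}
    {x y : unitPow K n ⟶ D}
    (h : ∀ i, Pt.map x (powPt _ n i) = Pt.map y (powPt _ n i)) : x = y := by
  ext
  refine biproduct.hom_ext' _ _ fun i => ?_
  have (z : unitPow K n ⟶ D) :
      biproduct.ι (fun _ : Fin n => 𝟙_ K) i ≫ homOf z = (Pt.map z (powPt _ n i)).toHom := by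
    rw [Pt.toHom_map]
    congr 1
    exact (Category.id_comp _).symm
  exact (this x).trans ((congrArg Pt.toHom (h i)).trans (this y).symm)

/-- The diagonal idempotent is `∑ εᵢ ⊗ εᵢ`. If it maps to `1` under `(x, y)`, multiplying by `x(εᵢ)`
and by `y(εᵢ)` shows that both equal `x(εᵢ) y(εᵢ)`. -/
theorem isSep_unitPow [HasFiniteBiproducts K] [IsIdempotentComplete K] (n : ℕ) :
    IsSep (unitPow K n) := by
  let P := unitPow K n
  let ε : Fin n → Pt P := powPt _ n
  have hε (i j) : ε i * ε j = if i = j then ε i else 0 := powPt_mul i j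
  have hε₁ : ∑ i, ε i = 1 := sum_powPt _ n
  refine isSep_of_eq_iff
    (e := ∑ i, Pt.map (inclLeft P P) (ε i) * Pt.map (inclRight P P) (ε i)) ?_ fun x y => ?_
  · rw [Finset.sum_mul_sum]
    refine Finset.sum_congr rfl fun i _ => ?_
    have (j : Fin n) : Pt.map (inclLeft P P) (ε i) * Pt.map (inclRight P P) (ε i) *
        (Pt.map (inclLeft P P) (ε j) * Pt.map (inclRight P P) (ε j)) =
        if i = j then Pt.map (inclLeft P P) (ε i) * Pt.map (inclRight P P) (ε i) else 0 := by
      rw [mul_mul_mul_comm, ← map_mul, ← map_mul, hε]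
      split_ifs <;> simp
    simp [this]
  · simp only [map_sum, map_mul, ← Pt.map_comp, inclLeft_desc, inclRight_desc]
    constructor
    · intro h
      refine powRing_trivial_hom_ext fun i => ?_
      have h₁ := congrArg (Pt.map x (ε i) * ·) h
      have h₂ := congrArg (Pt.map y (ε i) * ·) h
      simp only [Finset.mul_sum, mul_one] at h₁ h₂
      rw [Finset.sum_eq_single i (fun j _ hj => by
        rw [← mul_assoc, ← map_mul, hε, if_neg hj.symm, map_zero, zero_mul]) (by simp),
        ← mul_assoc, ← map_mul, hε, if_pos rfl] at h₁
      rw [Finset.sum_eq_single i (fun j _ hj => by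
        rw [mul_left_comm, ← map_mul, hε, if_neg hj.symm, map_zero, mul_zero]) (by simp),
        mul_left_comm, ← map_mul, hε, if_pos rfl] at h₂
      exact h₁.symm.trans h₂
    · rintro rfl
      rw [← map_one (Pt.map x), ← hε₁, map_sum]
      refine Finset.sum_congr rfl fun i _ => ?_
      rw [← map_mul, hε, if_pos rfl]

end Separable

noncomputable section Steps

variable {K : Type u} [Category.{v} K] [MonoidalCategory K] [SymmetricCategory K]
  {A R S S' T C D E : CommMon K}

/-! ### Relative tensor products as localizations -/

theorem homOf_tensorDesc_incl_right (h : C ⟶ D) (E : CommMon K) :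
    homOf (tensorDesc (h ≫ inclLeft D E) (inclRight D E)) = homOf h ▷ E.X := by
  change ((homOf h ≫ homOf (inclLeft D E)) ⊗ₘ homOf (inclRight D E)) ≫ μ = _
  rw [← Category.id_comp (homOf (inclRight D E)), ← tensorHom_comp_tensorHom, Category.assoc,
    incl_tensor_mul, Category.comp_id, tensorHom_id]

/-- The action of `R` on `S` as a homomorphism `S ⊗ R ⊗ S' ⟶ S ⊗ S'`. -/
def actLeft (f : R ⟶ S) (S' : CommMon K) :
    tensorRing (tensorRing S R) S' ⟶ tensorRing S S' :=
  tensorDesc (tensorDesc (inclLeft S S') (f ≫ inclLeft S S')) (inclRight S S')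

/-- The action of `R` on `S'` as a homomorphism `S ⊗ R ⊗ S' ⟶ S ⊗ S'`. -/
def actRight (S : CommMon K) (g : R ⟶ S') :
    tensorRing (tensorRing S R) S' ⟶ tensorRing S S' :=
  tensorDesc (tensorDesc (inclLeft S S') (g ≫ inclRight S S')) (inclRight S S')

theorem homOf_actLeft (f : R ⟶ S) (S' : CommMon K) :
    homOf (actLeft f S') = ((S.X ◁ homOf f) ≫ μ[S.X]) ▷ S'.X := by
  have : actLeft f S' =
      tensorDesc (tensorDesc (𝟙 S) f ≫ inclLeft S S') (inclRight S S') := by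
    rw [actLeft, tensorDesc_comp, Category.id_comp]
  rw [this, homOf_tensorDesc_incl_right]
  change ((𝟙 S.X ⊗ₘ homOf f) ≫ μ) ▷ S'.X = _
  rw [id_tensorHom]

theorem homOf_actRight (S : CommMon K) (g : R ⟶ S') :
    homOf (actRight S g) =
      (α_ S.X R.X S'.X).hom ≫ (S.X ◁ ((homOf g ▷ S'.X) ≫ μ[S'.X])) := by
  change (((homOf (inclLeft S S') ⊗ₘ homOf g ≫ homOf (inclRight S S')) ≫ μ) ⊗ₘ
    homOf (inclRight S S')) ≫ μ = _
  have h₁ : (homOf g ≫ homOf (inclRight S S') ⊗ₘ homOf (inclRight S S')) ≫ μ =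
      ((homOf g ▷ S'.X) ≫ μ) ≫ homOf (inclRight S S') := by
    rw [Category.assoc, IsMonHom.mul_hom (homOf (inclRight S S')), ← tensorHom_id,
      tensorHom_comp_tensorHom_assoc, Category.id_comp]
  have h₂ : (((homOf (inclLeft S S') ⊗ₘ homOf g ≫ homOf (inclRight S S')) ≫ μ) ⊗ₘ
      homOf (inclRight S S')) = (((homOf (inclLeft S S') ⊗ₘ homOf g ≫ homOf (inclRight S S'))) ⊗ₘ
      homOf (inclRight S S')) ≫ (μ ▷ (S.X ⊗ S'.X)) := by
    rw [← tensorHom_id, tensorHom_comp_tensorHom, Category.comp_id]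
  have h₃ : (homOf (inclLeft S S') ⊗ₘ (homOf g ≫ homOf (inclRight S S') ⊗ₘ
      homOf (inclRight S S'))) ≫ ((S.X ⊗ S'.X) ◁ μ) = (S.X ◁ ((homOf g ▷ S'.X) ≫ μ)) ≫
        (homOf (inclLeft S S') ⊗ₘ homOf (inclRight S S')) := by
    rw [← id_tensorHom, tensorHom_comp_tensorHom, h₁, ← id_tensorHom, tensorHom_comp_tensorHom,
      Category.comp_id, Category.id_comp]
  rw [h₂, Category.assoc, MonObj.mul_assoc, associator_naturality_assoc, reassoc_of% h₃,
    incl_tensor_mul, Category.comp_id]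

variable [Preadditive K] [MonoidalPreadditive K]

section

variable (hR : IsSep R) {f : R ⟶ S} {g : R ⟶ S'} {i : S ⟶ T} {j : S' ⟶ T}

theorem actLeft_comp_eq (w : f ≫ i = g ≫ j) :
    actLeft f S' ≫ tensorDesc i j = actRight S g ≫ tensorDesc i j := by
  rw [actLeft, actRight, tensorDesc_comp, tensorDesc_comp, tensorDesc_comp, tensorDesc_comp]
  simp [w]

theorem relTensor_condition_iff :
    (((S.X ◁ homOf f) ≫ μ[S.X]) ▷ S'.X) ≫ (homOf i ⊗ₘ homOf j) ≫ μ[T.X] =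
      ((α_ S.X R.X S'.X).hom ≫ (S.X ◁ ((homOf g ▷ S'.X) ≫ μ[S'.X]))) ≫
        (homOf i ⊗ₘ homOf j) ≫ μ[T.X] ↔ f ≫ i = g ≫ j := by
  rw [← homOf_actLeft, ← homOf_actRight]
  constructor
  · intro w
    have w' : actLeft f S' ≫ tensorDesc i j = actRight S g ≫ tensorDesc i j := by
      ext
      exact w
    have := congrArg (fun h => inclRight S R ≫ inclLeft (tensorRing S R) S' ≫ h) w'
    simpa [actLeft, actRight] using this
  · intro w
    exact congrArg homOf (actLeft_comp_eq w)

/-- The idempotent of `S ⊗ S'` which cuts out `S ⊗_R S'`. -/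
def relPt (f : R ⟶ S) (g : R ⟶ S') : Pt (tensorRing S S') :=
  eqPt hR (f ≫ inclLeft S S') (g ≫ inclRight S S')

theorem map_relPt_eq_one_iff {h : tensorRing S S' ⟶ E} :
    Pt.map h (relPt hR f g) = 1 ↔ f ≫ inclLeft S S' ≫ h = g ≫ inclRight S S' ≫ h := by
  rw [relPt, map_eqPt, eqPt_eq_one_iff, Category.assoc, Category.assoc]

/-- A morphism which coequalizes the two actions is unchanged by the idempotent of `S ⊗_R S'`. -/
theorem smul_relPt_comp {X : K} (k : S.X ⊗ S'.X ⟶ X)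
    (hk : homOf (actLeft f S') ≫ k = homOf (actRight S g) ≫ k) :
    (relPt hR f g).smul ≫ k = k := by
  let W : CommMon K := tensorRing (tensorRing S R) S'
  -- `ι'` is `s ⊗ s' ↦ s ⊗ 1 ⊗ s'`, a common section of both actions, and `e` is the locus where the
  -- middle factor `R` agrees with its image in `S'`. The left action sends `e` to the idempotent of
  -- `S ⊗_R S'`, the right action sends it to `1`. As `k` need not be a ring homomorphism, the
  -- comparison is made on multiplication operators.
  let ι' : tensorRing S S' ⟶ W := tensorDesc (inclLeft S R ≫ inclLeft _ _) (inclRight _ _)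
  let e : Pt W := eqPt hR (inclRight S R ≫ inclLeft _ _) (g ≫ inclRight _ _)
  have h₁ : ι' ≫ actLeft f S' = 𝟙 _ := tensor_hom_ext (by simp [ι', actLeft]) (by simp [ι', actLeft])
  have h₂ : ι' ≫ actRight S g = 𝟙 _ :=
    tensor_hom_ext (by simp [ι', actRight]) (by simp [ι', actRight])
  have h₃ : Pt.map (actLeft f S') e = relPt hR f g := by
    rw [map_eqPt]
    simp [actLeft, relPt]
  have h₄ : Pt.map (actRight S g) e = 1 := by
    rw [map_eqPt, eqPt_eq_one_iff]
    simp [actRight]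
  have h₁' : homOf ι' ≫ homOf (actLeft f S') = 𝟙 _ := congrArg homOf h₁
  have h₂' : homOf ι' ≫ homOf (actRight S g) = 𝟙 _ := congrArg homOf h₂
  have := congrArg (fun t => homOf ι' ≫ e.smul ≫ t) hk
  simp only [Pt.smul_comp_assoc, h₃, h₄, reassoc_of% h₁', reassoc_of% h₂', Pt.smul_one,
    Category.id_comp] at this
  exact this

theorem IsLoc.isRelTensor (h : IsLoc (tensorDesc i j) (relPt hR f g)) : IsRelTensor f g i j := by
  have w : f ≫ i = g ≫ j := by
    have := (map_relPt_eq_one_iff hR).1 h.map_eq_one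
    simpa using this
  have h' := h
  obtain ⟨s, h₁, h₂⟩ := h
  refine ⟨relTensor_condition_iff.2 w, ⟨Cofork.IsColimit.mk _ (fun c => s ≫ c.π) (fun c => ?_)
    fun c m hm => ?_⟩⟩
  · have hc := c.condition
    have hc : homOf (actLeft f S') ≫ c.π = homOf (actRight S g) ≫ c.π := by
      rw [homOf_actLeft, homOf_actRight, hc]
    change homOf (tensorDesc i j) ≫ s ≫ c.π = c.π
    rw [reassoc_of% h₂]
    exact smul_relPt_comp hR _ hc
  · have hm : homOf (tensorDesc i j) ≫ m = c.π := hm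
    rw [← hm, reassoc_of% h₁]

variable [IsIdempotentComplete K]

/-- The direct factor `Q` cut out by `relPt` also coequalizes the two actions, so the coequalizer
`T` maps to `Q`. Followed by the section of `Q`, this map splits `S ⊗ S' ⟶ T`. -/
theorem IsRelTensor.isLoc (h : IsRelTensor f g i j) :
    f ≫ i = g ≫ j ∧ IsLoc (tensorDesc i j) (relPt hR f g) := by
  obtain ⟨w', ⟨hc⟩⟩ := h
  have w : f ≫ i = g ≫ j := relTensor_condition_iff.1 w'
  refine ⟨w, ?_⟩
  obtain ⟨Q, q, hq⟩ := exists_isLoc (relPt hR f g) (eqPt_idem _ _ _)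
  have hq' := hq
  obtain ⟨s, h₁, h₂⟩ := hq'
  have hqw : f ≫ inclLeft S S' ≫ q = g ≫ inclRight S S' ≫ q :=
    (map_relPt_eq_one_iff hR).1 hq.map_eq_one
  have hπ : Pt.map (tensorDesc i j) (relPt hR f g) = 1 :=
    (map_relPt_eq_one_iff hR).2 (by simpa using w)
  have hact := congrArg homOf (actLeft_comp_eq hqw)
  rw [tensorDesc_eta] at hact
  have hact' : homOf (actLeft f S') ≫ homOf q = homOf (actRight S g) ≫ homOf q := hact
  rw [homOf_actLeft, homOf_actRight] at hact'
  let φ : T.X ⟶ Q.X := hc.desc (Cofork.ofπ (homOf q) hact')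
  have hφ : homOf (tensorDesc i j) ≫ φ = homOf q := hc.fac _ WalkingParallelPair.one
  refine ⟨φ ≫ s, ?_, ?_⟩
  · refine Cofork.IsColimit.hom_ext hc ?_
    change homOf (tensorDesc i j) ≫ (φ ≫ s) ≫ homOf (tensorDesc i j) =
      homOf (tensorDesc i j) ≫ 𝟙 _
    rw [Category.assoc, reassoc_of% hφ, reassoc_of% h₂, Pt.smul_comp, hπ, Pt.smul_one]
  · rw [reassoc_of% hφ, h₂]

end

/-! ### Splitting steps -/

variable [IsIdempotentComplete K]

/-- `S'` represents pairs of disjoint extensions along `f : R ⟶ S`, with universal pair `g, j`. -/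
structure IsStep (f : R ⟶ S) (g j : S ⟶ S') : Prop where
  disj : Disj g j
  comp_eq : f ≫ g = f ≫ j
  exists_desc {D : CommMon K} (u v : S ⟶ D) : f ≫ u = f ≫ v → Disj u v →
    ∃ w : S' ⟶ D, g ≫ w = u ∧ j ≫ w = v
  hom_ext {D : CommMon K} {w w' : S' ⟶ D} : g ≫ w = g ≫ w' → j ≫ w = j ≫ w' → w = w'

variable [HasBinaryBiproducts K]

theorem isZero_of_prodFst_comp_eq {a : C ⟶ E} {b : D ⟶ E}
    (w : prodFst C D ≫ a = prodSnd C D ≫ b) : IsZero E.X := by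
  have h₁ : Pt.map (prodFst C D ≫ a) (fstPt C D) = 1 := by
    rw [Pt.map_comp, map_fst_fstPt, map_one]
  have h₂ : Pt.map (prodSnd C D ≫ b) (fstPt C D) = 0 := by
    rw [Pt.map_comp, map_snd_fstPt, map_zero]
  rw [isZero_iff_one_eq_zero, ← h₁, w, h₂]

/-- A pair `u, v` agreeing on `R` is a homomorphism out of `S ⊗_R S ≅ S × S'`. Where the first
idempotent becomes `1` it factors through the multiplication, so `u` and `v` agree there. Disjoint
pairs are thus exactly the homomorphisms out of the factor `S'`. -/
theorem IsSplittingStep.exists_isStep (hR : IsSep R) {f : R ⟶ S} {g : S ⟶ S'}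
    (h : IsSplittingStep f g) : ∃ j : S ⟶ S', IsStep f g j := by
  obtain ⟨T, i, j, φ, hT, hi, hμ⟩ := h
  obtain ⟨w, hπ⟩ := hT.isLoc hR
  have hi₁ : i ≫ φ.hom ≫ prodFst S S' = 𝟙 S := by rw [reassoc_of% hi, prodLift_fst]
  have hi₂ : i ≫ φ.hom ≫ prodSnd S S' = g := by rw [reassoc_of% hi, prodLift_snd]
  have hμ' : tensorDesc i j ≫ φ.hom ≫ prodFst S S' = codiag S := by
    ext
    exact hμ.trans (homOf_codiag S).symm
  have hj₁ : j ≫ φ.hom ≫ prodFst S S' = 𝟙 S := by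
    have := congrArg (inclRight S S ≫ ·) hμ'
    simpa using this
  refine ⟨j ≫ φ.hom ≫ prodSnd S S', ⟨?_, ?_, ?_, ?_⟩⟩
  · intro E y hy
    have h₁ : tensorDesc i j ≫ φ.hom ≫ prodSnd S S' ≫ y =
        tensorDesc i j ≫ φ.hom ≫ prodFst S S' ≫ g ≫ y := by
      apply tensor_hom_ext
      · rw [inclLeft_desc_assoc, inclLeft_desc_assoc, reassoc_of% hi₂, reassoc_of% hi₁]
      · rw [inclRight_desc_assoc, inclRight_desc_assoc, reassoc_of% hj₁, hy]
        simp
    have h₂ := (cancel_epi φ.hom).1 (hπ.hom_ext h₁)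
    exact isZero_of_prodFst_comp_eq h₂.symm
  · rw [← reassoc_of% w, hi₂]
  · intro D u v huv hdisj
    obtain ⟨t, ht⟩ := hπ.exists_lift (tensorDesc u v)
      ((map_relPt_eq_one_iff hR).2 (by simpa using huv))
    have htu : i ≫ t = u := by
      have := congrArg (inclLeft S S ≫ ·) ht
      simpa using this
    have htv : j ≫ t = v := by
      have := congrArg (inclRight S S ≫ ·) ht
      simpa using this
    have h₀ : Pt.map (φ.inv ≫ t) (fstPt S S') = 0 := by
      refine idem_eq_zero (by rw [← map_mul, (isLoc_prodFst S S').idem]) fun p hp => ?_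
      rw [← Pt.map_comp] at hp
      obtain ⟨z, hz⟩ := (isLoc_prodFst S S').exists_lift _ hp
      refine hdisj p ?_
      have hz' : t ≫ p = φ.hom ≫ prodFst S S' ≫ z := by rw [hz]; simp
      rw [← htu, ← htv, Category.assoc, Category.assoc, hz', reassoc_of% hi₁, reassoc_of% hj₁]
    have h₁ : Pt.map (φ.inv ≫ t) (sndPt S S') = 1 := by
      rw [← map_one (Pt.map (φ.inv ≫ t)), ← fstPt_add_sndPt, map_add, h₀, zero_add]
    obtain ⟨z, hz⟩ := (isLoc_prodSnd S S').exists_lift _ h₁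
    have hz' : φ.hom ≫ prodSnd S S' ≫ z = t := by rw [hz]; simp
    exact ⟨z, by rw [← hi₂, Category.assoc, Category.assoc, hz', htu],
      by rw [Category.assoc, Category.assoc, hz', htv]⟩
  · intro D w₁ w₂ h₁ h₂
    refine (isLoc_prodSnd S S').hom_ext ((cancel_epi φ.hom).1 (hπ.hom_ext ?_))
    apply tensor_hom_ext
    · rw [inclLeft_desc_assoc, inclLeft_desc_assoc, reassoc_of% hi₂, reassoc_of% hi₂, h₁]
    · rw [inclRight_desc_assoc, inclRight_desc_assoc]
      simpa using h₂

/-- In `S ⊗ S` let `d` be the diagonal idempotent and `r` that of `S ⊗_R S`. Homomorphisms that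
agree on `S` agree on `R`, so `r * d = d`, and `r - d` is an idempotent cutting out the complement
`S'`. -/
theorem exists_isSplittingStep (hR : IsSep R) (hS : IsSep S) (f : R ⟶ S) :
    ∃ (S' : CommMon K) (g : S ⟶ S'), IsSep S' ∧ IsSplittingStep f g := by
  let d : Pt (tensorRing S S) := eqPt hS (inclLeft S S) (inclRight S S)
  let r : Pt (tensorRing S S) := relPt hR f f
  have hd : d * d = d := eqPt_idem _ _ _
  have hr : r * r = r := eqPt_idem _ _ _
  have hrd : r * d = d := idem_mul_eq hd fun p hp => by
    rw [map_eqPt, eqPt_eq_one_iff] at hp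
    rw [map_relPt_eq_one_iff, hp]
  have hc : IsLoc (codiag S) d := by
    refine IsLoc.of_universal hd ?_ (fun {E} h hh => ?_) fun h hh => ?_
    · rw [map_eqPt, eqPt_eq_one_iff, inclLeft_desc, inclRight_desc]
    · rw [map_eqPt, eqPt_eq_one_iff] at hh
      refine ⟨inclLeft S S ≫ h, ?_⟩
      rw [codiag_comp]
      conv_rhs => rw [← tensorDesc_eta h, ← hh]
    · have := congrArg (inclLeft S S ≫ ·) hh
      simpa using this
  obtain ⟨S', q, hq⟩ := exists_isLoc (r - d) (by linear_combination hr - 2 * hrd + hd)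
  obtain ⟨T, π, hπ⟩ := exists_isLoc r hr
  have h₁ : Pt.map (codiag S) r = 1 := by
    rw [← mul_one (Pt.map _ r), ← hc.map_eq_one, ← map_mul, hrd]
  have h₂ : Pt.map q r = 1 := by
    rw [← mul_one (Pt.map _ r), ← hq.map_eq_one, ← map_mul, mul_sub, hr, hrd]
  obtain ⟨a, ha⟩ := hπ.exists_lift _ h₁
  obtain ⟨b, hb⟩ := hπ.exists_lift _ h₂
  have ha' := hπ.of_comp (q := a) (e' := d) (by rwa [ha])
  have hb' := hπ.of_comp (q := b) (e' := r - d) (by rwa [hb])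
  obtain ⟨φ, hφ⟩ := exists_iso_prodLift ha' hb' (by
    rw [← map_add, add_sub_cancel, hπ.map_eq_one])
  refine ⟨S', inclLeft S S ≫ q, (hS.tensor hS).of_isLoc hq, T, inclLeft S S ≫ π,
    inclRight S S ≫ π, φ, ?_, ?_, ?_⟩
  · refine IsLoc.isRelTensor hR ?_
    rwa [tensorDesc_eta]
  · rw [hφ, comp_prodLift, Category.assoc, Category.assoc, ha, hb, inclLeft_desc]
  · rw [hφ, prodLift_fst]
    refine Eq.trans ?_ (homOf_codiag S)
    rw [← ha]
    exact congrArg (fun h => homOf (h ≫ a)) (tensorDesc_eta π)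

end Steps

noncomputable section Configurations

variable {K : Type u} [Category.{v} K] [MonoidalCategory K] [Preadditive K]
  [MonoidalPreadditive K] [SymmetricCategory K] [IsIdempotentComplete K]
  {A B C D R R' S S' : CommMon K} {n : ℕ}

/-! ### Rings representing tuples of disjoint points -/

/-- `R`, with the homomorphisms `a k : A ⟶ R`, represents tuples of pairwise disjoint
homomorphisms out of `A`. -/
structure IsConf (a : Fin n → (A ⟶ R)) : Prop where
  disj : Pairwise fun k l => Disj (a k) (a l)
  exists_desc {D : CommMon K} (b : Fin n → (A ⟶ D)) :
    (Pairwise fun k l => Disj (b k) (b l)) → ∃ w : R ⟶ D, ∀ k, a k ≫ w = b k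
  hom_ext {D : CommMon K} {w w' : R ⟶ D} : (∀ k, a k ≫ w = a k ≫ w') → w = w'

theorem pairwise_snoc {α : Type*} {r : α → α → Prop} (hr : ∀ x y, r x y → r y x) {a : Fin n → α}
    (ha : Pairwise fun k l => r (a k) (a l)) {x : α} (hx : ∀ k, r (a k) x) :
    Pairwise fun k l => r (Fin.snoc (α := fun _ => α) a x k) (Fin.snoc (α := fun _ => α) a x l) := by
  intro k l
  refine Fin.lastCases ?_ (fun k => ?_) k <;> refine Fin.lastCases ?_ (fun l => ?_) l
  · exact fun h => absurd rfl h
  · intro _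
    simpa using hr _ _ (hx l)
  · intro _
    simpa using hx k
  · intro h
    simpa using ha (fun h' => h (congrArg _ h'))

theorem pairwise_comp_castSucc {α : Type*} {r : α → α → Prop} {a : Fin (n + 1) → α}
    (ha : Pairwise fun k l => r (a k) (a l)) :
    Pairwise fun k l : Fin n => r (a k.castSucc) (a l.castSucc) :=
  fun _ _ h => ha fun h' => h (Fin.castSucc_injective n h')

theorem isConf_zero (φ : R ≅ CommMon.trivial K) (a : Fin 0 → (A ⟶ R)) : IsConf a where
  disj k := k.elim0
  exists_desc _ _ := ⟨φ.hom ≫ default, fun k => k.elim0⟩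
  hom_ext _ := (cancel_epi φ.inv).1 (Subsingleton.elim _ _)

theorem isConf_one (φ : R ≅ A) : IsConf fun _ : Fin 1 => φ.inv where
  disj k l h := absurd (Subsingleton.elim k l) h
  exists_desc b _ := ⟨φ.hom ≫ b 0, fun k => by rw [Subsingleton.elim k 0]; simp⟩
  hom_ext h := (cancel_epi φ.inv).1 (h 0)

theorem IsConf.exists_iso {a : Fin n → (A ⟶ R)} {b : Fin n → (A ⟶ R')} (ha : IsConf a)
    (hb : IsConf b) : ∃ φ : R ≅ R', ∀ k, a k ≫ φ.hom = b k := by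
  obtain ⟨f, hf⟩ := ha.exists_desc b hb.disj
  obtain ⟨g, hg⟩ := hb.exists_desc a ha.disj
  refine ⟨⟨f, g, ha.hom_ext fun k => ?_, hb.hom_ext fun k => ?_⟩, hf⟩
  · rw [reassoc_of% (hf k), hg, Category.comp_id]
  · rw [reassoc_of% (hg k), hf, Category.comp_id]

theorem IsConf.isZero_iff {a : Fin n → (A ⟶ R)} {b : Fin n → (A ⟶ R')} (ha : IsConf a)
    (hb : IsConf b) : IsZero R.X ↔ IsZero R'.X := by
  obtain ⟨φ, -⟩ := ha.exists_iso hb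
  exact ⟨isZero_of_hom φ.hom, isZero_of_hom φ.inv⟩

/-- Adding a further point to the `n + 1` points of `S`. -/
theorem IsConf.step {f : R ⟶ S} {g j : S ⟶ S'} (h : IsStep f g j) {a : Fin n → (A ⟶ R)}
    {b : Fin (n + 1) → (A ⟶ S)} (ha : IsConf a) (hb : IsConf b)
    (hab : ∀ k, b k.castSucc = a k ≫ f) :
    IsConf (Fin.snoc (α := fun _ => (A ⟶ S')) (fun k => b k ≫ g) (b (Fin.last n) ≫ j)) where
  disj := by
    refine pairwise_snoc (r := Disj) (fun _ _ h => h.symm) (fun k l hkl => Disj.comp (hb.disj hkl) g)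
      fun k => ?_
    refine Fin.lastCases ?_ (fun k => ?_) k
    · intro y hy
      -- The points `b k` with `k < n` come from `R`, where `g` and `j` agree anyway. Agreement of
      -- the last points therefore forces `g ≫ y = j ≫ y`.
      refine h.disj y (hb.hom_ext fun k => ?_)
      refine Fin.lastCases ?_ (fun k => ?_) k
      · simpa using hy
      · rw [hab, Category.assoc, reassoc_of% h.comp_eq, Category.assoc]
    · have : b k.castSucc ≫ g = b k.castSucc ≫ j := by
        rw [hab, Category.assoc, h.comp_eq, Category.assoc]
      rw [this]
      exact Disj.comp (hb.disj (Fin.castSucc_lt_last k).ne) j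
  exists_desc {D} x hx := by
    obtain ⟨u, hu⟩ := hb.exists_desc (fun k => x k.castSucc) (pairwise_comp_castSucc (r := Disj) hx)
    -- `u` classifies all points but the last and `v` all but the second to last. They agree on `R`,
    -- and are disjoint because their last points are.
    obtain ⟨v, hv⟩ := hb.exists_desc
      (Fin.snoc (α := fun _ => (A ⟶ D)) (fun k => x k.castSucc.castSucc) (x (Fin.last _)))
      (pairwise_snoc (r := Disj) (fun _ _ h => h.symm)
        (pairwise_comp_castSucc (r := Disj) (pairwise_comp_castSucc (r := Disj) hx))
        fun k => hx (Fin.castSucc_lt_last _).ne)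
    have hvl : b (Fin.last n) ≫ v = x (Fin.last _) := by rw [hv]; simp
    have hvc (k : Fin n) : b k.castSucc ≫ v = x k.castSucc.castSucc := by rw [hv]; simp
    have huv : f ≫ u = f ≫ v := ha.hom_ext fun k => by
      rw [← Category.assoc, ← Category.assoc, ← hab, hu, hvc]
    have hd : Disj (b (Fin.last n) ≫ u) (b (Fin.last n) ≫ v) := by
      rw [hu, hvl]
      exact hx (Fin.castSucc_lt_last _).ne
    obtain ⟨w, hw₁, hw₂⟩ := h.exists_desc u v huv hd.of_precomp
    refine ⟨w, fun k => ?_⟩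
    refine Fin.lastCases ?_ (fun k => ?_) k
    · simp [hw₂, hvl]
    · simp [hw₁, hu]
  hom_ext {D w w'} hw := by
    have h₁ : g ≫ w = g ≫ w' := hb.hom_ext fun k => by simpa using hw k.castSucc
    refine h.hom_ext h₁ (hb.hom_ext fun k => ?_)
    refine Fin.lastCases ?_ (fun k => ?_) k
    · simpa using hw (Fin.last _)
    · have : b k.castSucc ≫ j = b k.castSucc ≫ g := by
        rw [hab, Category.assoc, ← h.comp_eq, Category.assoc]
      rw [reassoc_of% this, h₁, reassoc_of% this]

variable [HasBinaryBiproducts K]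

/-! ### Splitting towers -/

/-- Two consecutive stages are carried through the induction, since a splitting step depends on the
map between them. The induction starts with the initial ring (no points) and `A` (one point). -/
theorem SplittingTower.exists_isConf (T : SplittingTower A) (n : ℕ) :
    ∃ (a : Fin n → (A ⟶ T.obj n)) (b : Fin (n + 1) → (A ⟶ T.obj (n + 1))),
      IsConf a ∧ IsConf b ∧ ∀ k, b k.castSucc = a k ≫ T.map n := by
  induction n with
  | zero => exact ⟨fun k => k.elim0, _, isConf_zero T.isoZero _, isConf_one T.isoOne,
      fun k => k.elim0⟩
  | succ n ih =>
    obtain ⟨a, b, ha, hb, hab⟩ := ih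
    obtain ⟨j, hj⟩ := (T.step n).exists_isStep (T.separable n).isSep
    exact ⟨b, _, hb, ha.step hj hb hab, fun k => by simp⟩

/-- A homomorphism between separable rings. -/
structure StepData (K : Type u) [Category.{v} K] [MonoidalCategory K] [SymmetricCategory K]
    [Preadditive K] [MonoidalPreadditive K] where
  /-- The source. -/
  src : CommMon K
  /-- The target. -/
  tgt : CommMon K
  /-- The homomorphism. -/
  hom : src ⟶ tgt
  isSep_src : IsSep src
  isSep_tgt : IsSep tgt

/-- The next homomorphism of a splitting tower. -/
def StepData.next (d : StepData K) : StepData K where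
  src := d.tgt
  tgt := (exists_isSplittingStep d.isSep_src d.isSep_tgt d.hom).choose
  hom := (exists_isSplittingStep d.isSep_src d.isSep_tgt d.hom).choose_spec.choose
  isSep_src := d.isSep_tgt
  isSep_tgt := (exists_isSplittingStep d.isSep_src d.isSep_tgt d.hom).choose_spec.choose_spec.1

theorem StepData.isSplittingStep_next (d : StepData K) : IsSplittingStep d.hom d.next.hom :=
  (exists_isSplittingStep d.isSep_src d.isSep_tgt d.hom).choose_spec.choose_spec.2

/-- The iterates of `StepData.next`, starting with the unit of a separable ring. -/
def towerData (hA : IsSep A) : ℕ → StepData K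
  | 0 => ⟨CommMon.trivial K, A, default, isSep_trivial, hA⟩
  | n + 1 => (towerData hA n).next

/-- The splitting tower of a separable ring. -/
def splittingTower (hA : IsSep A) : SplittingTower A where
  obj n := (towerData hA n).src
  map n := (towerData hA n).hom
  separable n := (towerData hA n).isSep_src.isSeparableRing
  isoZero := Iso.refl _
  isoOne := Iso.refl _
  step n := (towerData hA n).isSplittingStep_next

/-! ### The degree -/

theorem SplittingTower.isZero_of_le (T : SplittingTower A) {m n : ℕ} (h : m ≤ n)
    (hm : IsZero (T.obj m).X) : IsZero (T.obj n).X := by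
  induction n, h using Nat.le_induction with
  | base => exact hm
  | succ n _ ih => exact isZero_of_hom (T.map n) ih

theorem SplittingTower.isZero_iff (T T' : SplittingTower A) (n : ℕ) :
    IsZero (T.obj n).X ↔ IsZero (T'.obj n).X := by
  obtain ⟨a, -, ha, -⟩ := T.exists_isConf n
  obtain ⟨a', -, ha', -⟩ := T'.exists_isConf n
  exact ha.isZero_iff ha'

theorem SplittingTower.hasDegree_iff (T : SplittingTower A) (d : ℕ) :
    HasDegree A d ↔ ¬ IsZero (T.obj d).X ∧ IsZero (T.obj (d + 1)).X := by
  constructor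
  · rintro ⟨T', h⟩
    rwa [T'.isZero_iff T, T'.isZero_iff T] at h
  · exact fun h => ⟨T, h⟩

theorem HasDegree.eq {d d' : ℕ} (h : HasDegree A d) (h' : HasDegree A d') : d = d' := by
  obtain ⟨T, hT⟩ := h
  rw [T.hasDegree_iff] at h'
  by_contra hne
  rcases lt_or_gt_of_ne hne with hlt | hlt
  · exact h'.1 (T.isZero_of_le hlt hT.2)
  · exact hT.1 (T.isZero_of_le hlt h'.2)

/-- The infimum defining `deg` runs over at most one number; over the empty set it is `⊤`, which is
not a natural number. -/
theorem deg_eq_iff (d : ℕ) : deg A = d ↔ HasDegree A d := by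
  constructor
  · intro h
    by_cases hex : ∃ d', HasDegree A d'
    · obtain ⟨d', hd'⟩ := hex
      have : deg A = d' := by
        refine le_antisymm (iInf₂_le d' hd') (le_iInf₂ fun e he => ?_)
        rw [hd'.eq he]
      rw [h] at this
      rwa [Nat.cast_inj.1 this]
    · have : deg A = ⊤ := by
        refine iInf_eq_top.2 fun e => iInf_eq_top.2 fun he => absurd ⟨e, he⟩ hex
      rw [h] at this
      exact absurd this (ENat.natCast_ne_top d)
  · intro h
    refine le_antisymm (iInf₂_le d h) (le_iInf₂ fun e he => ?_)
    rw [h.eq he]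

theorem deg_eq_of_isConf (hA : IsSep A) {d : ℕ} {a : Fin d → (A ⟶ R)}
    {b : Fin (d + 1) → (A ⟶ S)} (ha : IsConf a) (hb : IsConf b) (hR : ¬ IsZero R.X)
    (hS : IsZero S.X) : deg A = d := by
  rw [deg_eq_iff, (splittingTower hA).hasDegree_iff]
  obtain ⟨a', b', ha', hb', -⟩ := (splittingTower hA).exists_isConf d
  rw [← ha.isZero_iff ha', ← hb.isZero_iff hb']
  exact ⟨hR, hS⟩

end Configurations

noncomputable section Splitting

variable {K : Type u} [Category.{v} K] [MonoidalCategory K] [Preadditive K]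
  [MonoidalPreadditive K] [SymmetricCategory K] [IsIdempotentComplete K]
  {A B C D E R S : CommMon K} {n d : ℕ}

/-! ### Extension of scalars along a stage of the tower -/

/-- The idempotent of `R ⊗ A` where the point of `A` agrees with a given `x : A ⟶ R`. -/
def pointPt (hA : IsSep A) (x : A ⟶ R) : Pt (tensorRing R A) :=
  eqPt hA (x ≫ inclLeft R A) (inclRight R A)

theorem map_pointPt_eq_one_iff (hA : IsSep A) (x : A ⟶ R) (q : tensorRing R A ⟶ D) :
    Pt.map q (pointPt hA x) = 1 ↔ x ≫ inclLeft R A ≫ q = inclRight R A ≫ q := by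
  rw [pointPt, map_eqPt, eqPt_eq_one_iff, Category.assoc]

theorem map_pointPt_eq_zero_iff (hA : IsSep A) (x : A ⟶ R) (q : tensorRing R A ⟶ D) :
    Pt.map q (pointPt hA x) = 0 ↔ Disj (x ≫ inclLeft R A ≫ q) (inclRight R A ≫ q) := by
  rw [pointPt, map_eqPt, eqPt_eq_zero_iff, Category.assoc]

theorem pointPt_mul (hA : IsSep A) {x y : A ⟶ R} (h : Disj x y) :
    pointPt hA x * pointPt hA y = 0 := by
  refine idem_eq_zero (by rw [mul_mul_mul_comm, pointPt, pointPt, eqPt_idem, eqPt_idem])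
    fun p hp => h (inclLeft R A ≫ p) ?_
  rw [map_mul, mul_eq_one_iff_of_idem (by rw [← map_mul, pointPt, eqPt_idem])
    (by rw [← map_mul, pointPt, eqPt_idem]), map_pointPt_eq_one_iff, map_pointPt_eq_one_iff] at hp
  rw [hp.1, hp.2]

/-- A homomorphism out of `R ⊗ A` whose second component is the first composed with `x` is
determined by the first, so this locus is a copy of `R`. -/
theorem isLoc_pointPt (hA : IsSep A) (x : A ⟶ R) :
    IsLoc (tensorDesc (𝟙 R) x) (pointPt hA x) := by
  refine IsLoc.of_universal (eqPt_idem _ _ _) ?_ (fun {E} f hf => ?_) fun f hf => ?_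
  · rw [map_pointPt_eq_one_iff]
    simp
  · rw [map_pointPt_eq_one_iff] at hf
    refine ⟨inclLeft R A ≫ f, tensor_hom_ext (by simp) ?_⟩
    rw [inclRight_desc_assoc, hf]
  · have := congrArg (inclLeft R A ≫ ·) hf
    simpa using this

theorem map_one_sub_sum_eq_one_iff {e : Fin n → Pt C} (he : ∀ i, e i * e i = e i)
    (he' : ∀ i j, i ≠ j → e i * e j = 0) (q : C ⟶ D) :
    Pt.map q (1 - ∑ i, e i) = 1 ↔ ∀ i, Pt.map q (e i) = 0 := by
  constructor
  · intro h i
    have : e i * (1 - ∑ j, e j) = 0 := by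
      rw [mul_sub, mul_one, Finset.mul_sum,
        Finset.sum_eq_single i (fun j _ hj => he' i j hj.symm) (by simp), he, sub_self]
    rw [← mul_one (Pt.map q (e i)), ← h, ← map_mul, this, map_zero]
  · intro h
    rw [map_sub, map_sum, Finset.sum_eq_zero fun i _ => h i, map_one, sub_zero]

theorem idem_one_sub_sum {e : Fin n → Pt C} (he : ∀ i, e i * e i = e i)
    (he' : ∀ i j, i ≠ j → e i * e j = 0) :
    (1 - ∑ i, e i) * (1 - ∑ i, e i) = 1 - ∑ i, e i := by
  have : (∑ i, e i) * ∑ i, e i = ∑ i, e i := by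
    rw [Finset.sum_mul_sum]
    refine Finset.sum_congr rfl fun i _ => ?_
    rw [Finset.sum_eq_single i (fun j _ hj => he' i j hj.symm) (by simp), he]
  linear_combination this

section

variable (hA : IsSep A) {a : Fin n → (A ⟶ R)} {b : Fin (n + 1) → (A ⟶ S)} (ha : IsConf a)
  (hb : IsConf b) {f : R ⟶ S} (hab : ∀ k, b k.castSucc = a k ≫ f)

-- A homomorphism out of `R ⊗ A` is a tuple of `n` disjoint points with one more point. It kills
-- every `pointPt` iff the extra point is disjoint from the others, which is what `S` represents.
include ha hb hab in
theorem IsConf.isLoc_next :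
    IsLoc (tensorDesc f (b (Fin.last n))) (1 - ∑ k, pointPt hA (a k)) := by
  have he (i) : pointPt hA (a i) * pointPt hA (a i) = pointPt hA (a i) := eqPt_idem _ _ _
  have he' (i j) (hij : i ≠ j) : pointPt hA (a i) * pointPt hA (a j) = 0 :=
    pointPt_mul hA (ha.disj hij)
  refine IsLoc.of_universal (idem_one_sub_sum he he') ?_ (fun {E} q hq => ?_) fun h hh => ?_
  · rw [map_one_sub_sum_eq_one_iff he he']
    intro i
    rw [map_pointPt_eq_zero_iff, inclLeft_desc, inclRight_desc, ← hab]
    exact hb.disj (Fin.castSucc_lt_last i).ne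
  · simp only [map_one_sub_sum_eq_one_iff he he', map_pointPt_eq_zero_iff] at hq
    obtain ⟨w, hw⟩ := hb.exists_desc
      (Fin.snoc (α := fun _ => (A ⟶ E)) (fun k => a k ≫ inclLeft R A ≫ q) (inclRight R A ≫ q))
      (pairwise_snoc (r := Disj) (fun _ _ h => h.symm)
        (fun k l hkl => Disj.comp (ha.disj hkl) (inclLeft R A ≫ q)) hq)
    refine ⟨w, tensor_hom_ext ?_ ?_⟩
    · rw [inclLeft_desc_assoc]
      refine ha.hom_ext fun k => ?_
      rw [← Category.assoc, ← hab, hw]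
      simp
    · rw [inclRight_desc_assoc, hw]
      simp
  · have h₁ := congrArg (inclLeft R A ≫ ·) hh
    have h₂ := congrArg (inclRight R A ≫ ·) hh
    simp only [inclLeft_desc, inclLeft_desc_assoc, inclRight_desc, inclRight_desc_assoc] at h₁ h₂
    refine hb.hom_ext fun k => ?_
    refine Fin.lastCases ?_ (fun k => ?_) k
    · rw [h₂, Category.comp_id]
    · rw [hab, Category.assoc, h₁, Category.comp_id]

variable [HasFiniteBiproducts K] [HasBinaryBiproducts K]

include ha in
theorem IsConf.isLoc_points :
    IsLoc (powLift fun k => tensorDesc (𝟙 R) (a k)) (∑ k, pointPt hA (a k)) :=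
  isLoc_powLift (fun k => isLoc_pointPt hA (a k)) fun _ _ hij => pointPt_mul hA (ha.disj hij)

theorem inclLeft_powLift :
    inclLeft R A ≫ powLift (fun k => tensorDesc (𝟙 R) (a k)) = powDiag R n :=
  pow_hom_ext fun i => by rw [Category.assoc, powLift_proj, inclLeft_desc, powDiag_proj]

include hA ha hb hab in
theorem IsConf.extScalars_iso :
    Nonempty (extScalars R A ≅ prodAlg (unitPowAlg R n) (Under.mk f)) := by
  obtain ⟨φ, hφ⟩ := exists_iso_prodLift (ha.isLoc_points hA) (ha.isLoc_next hA hb hab)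
    (add_sub_cancel _ _)
  refine ⟨Under.isoMk φ ?_⟩
  change inclLeft R A ≫ φ.hom = prodLift (powDiag R n) f
  rw [hφ, comp_prodLift, inclLeft_powLift, inclLeft_desc]

include hA ha hb hab in
theorem IsConf.extScalars_iso_of_isZero (hS : IsZero S.X) :
    Nonempty (extScalars R A ≅ unitPowAlg R n) := by
  have h := ha.isLoc_points hA
  -- This idempotent cuts out `S = 0`, so the first `n` factors already exhaust `R ⊗ A`.
  have h₁ : (1 - ∑ k, pointPt hA (a k)).toHom = 0 := by
    obtain ⟨s, -, hs⟩ := ha.isLoc_next hA hb hab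
    rw [← Pt.one_comp_smul, ← hs, hS.eq_of_src s 0, comp_zero, comp_zero]
  have h₂ : ∑ k, pointPt hA (a k) = 1 := (sub_eq_zero.1 h₁).symm
  rw [h₂] at h
  obtain ⟨s, s₁, s₂⟩ := h
  rw [Pt.smul_one] at s₂
  obtain ⟨φ, hφ⟩ := exists_iso_of_inverse _ s s₂ s₁
  refine ⟨Under.isoMk φ ?_⟩
  change inclLeft R A ≫ φ.hom = powDiag R n
  rw [hφ, inclLeft_powLift]

end

/-! ### Completely split rings -/

/-- The pairwise disjoint homomorphisms `x i : A ⟶ B` cover `A` over `B`. -/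
structure IsSplit (x : Fin d → (A ⟶ B)) : Prop where
  disj : Pairwise fun i j => Disj (x i) (x j)
  cover {D : CommMon K} (β : B ⟶ D) (y : A ⟶ D) : (∀ i, Disj (x i ≫ β) y) → IsZero D.X

/-- Pigeonhole principle: over `B` there are at most `d` pairwise disjoint points of a ring which
is split by `d` points. -/
theorem IsSplit.isZero_of_lt {x : Fin d → (A ⟶ B)} (hx : IsSplit x) (β : B ⟶ D) {m : ℕ}
    {a : Fin m → (A ⟶ D)} (ha : Pairwise fun k l => Disj (a k) (a l)) (hm : d < m) :
    IsZero D.X := by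
  by_contra hD
  -- Pass to ever smaller nonzero loci: by covering, the next `a j` is not disjoint from some `x i`,
  -- so the two agree over a further nonzero ring. At `k = m` two of the `a j` equal the same `x i`,
  -- against disjointness.
  have key (k : ℕ) : ∃ (E : CommMon K) (g : D ⟶ E), ¬ IsZero E.X ∧
      ∀ j : Fin m, (j : ℕ) < k → ∃ i, a j ≫ g = x i ≫ β ≫ g := by
    induction k with
    | zero => exact ⟨D, 𝟙 D, hD, fun j hj => absurd hj (Nat.not_lt_zero _)⟩
    | succ k ih =>
      obtain ⟨E, g, hE, hg⟩ := ih
      by_cases hk : k < m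
      · have : ∃ i, ¬ Disj (x i ≫ β ≫ g) (a ⟨k, hk⟩ ≫ g) := by
          by_contra! h
          exact hE (hx.cover _ _ h)
        obtain ⟨i, hi⟩ := this
        simp only [Disj, not_forall] at hi
        obtain ⟨E', g', hg', hE'⟩ := hi
        refine ⟨E', g ≫ g', hE', fun j hj => ?_⟩
        rcases Nat.lt_succ_iff_lt_or_eq.1 hj with h | h
        · obtain ⟨i', hi'⟩ := hg j h
          exact ⟨i', by rw [reassoc_of% hi']⟩
        · have : j = ⟨k, hk⟩ := Fin.ext h
          exact ⟨i, by rw [this, ← Category.assoc, ← hg']; simp⟩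
      · exact ⟨E, g, hE, fun j hj => hg j (by omega)⟩
  obtain ⟨E, g, hE, hg⟩ := key m
  choose φ hφ using fun j : Fin m => hg j j.2
  obtain ⟨k, l, hkl, h⟩ := Fintype.exists_ne_map_eq_of_card_lt φ (by simpa using hm)
  exact hE (ha hkl g (by rw [hφ, hφ, h]))

variable [HasFiniteBiproducts K] [HasBinaryBiproducts K]

/-- Where the `i`-th standard idempotent becomes `1`, the map `z` factors through the `i`-th
projection, and the factor is read off by composing with the diagonal. If each of these loci is
zero, so is `1`, the sum of the idempotents. -/
theorem isZero_of_powRing_hom (z : powRing B d ⟶ D)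
    (h : ∀ (i : Fin d) {E : CommMon K} (g : D ⟶ E),
      z ≫ g = powProj B d i ≫ powDiag B d ≫ z ≫ g → IsZero E.X) : IsZero D.X := by
  rw [isZero_iff_one_eq_zero, ← map_one (Pt.map z), ← sum_powPt, map_sum]
  refine Finset.sum_eq_zero fun i _ => idem_eq_zero (by rw [← map_mul, powPt_mul, if_pos rfl])
    fun g hg => h i g ?_
  rw [← Pt.map_comp] at hg
  obtain ⟨t, ht⟩ := (isLoc_powProj i).exists_lift _ hg
  rw [← ht, powDiag_proj_assoc]

theorem disj_powProj {i j : Fin d} (h : i ≠ j) : Disj (powProj B d i) (powProj B d j) := by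
  intro E g hg
  have := congrArg (fun t => Pt.map t (powPt B d i)) hg
  simp only [Pt.map_comp, map_proj_powPt, if_neg h, if_true, map_one, map_zero] at this
  rwa [isZero_iff_one_eq_zero]

/-- The points are the `d` projections restricted to `A`. A further point over a `B`-algebra is a
map out of `B ⊗ A ≅ Bᵈ`, and on the `i`-th locus it agrees with the `i`-th point. -/
theorem isSplit_of_extScalars_iso (φ : extScalars B A ≅ unitPowAlg B d) :
    IsSplit fun i => inclRight B A ≫ φ.hom.right ≫ powProj B d i := by
  have hw : inclLeft B A ≫ φ.hom.right = powDiag B d := Under.w φ.hom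
  have h₁ : φ.hom.right ≫ φ.inv.right = 𝟙 _ := by rw [← Under.comp_right, φ.hom_inv_id]; rfl
  have h₂ : φ.inv.right ≫ φ.hom.right = 𝟙 _ := by rw [← Under.comp_right, φ.inv_hom_id]; rfl
  have hφ : IsIso φ.hom.right := ⟨_, h₁, h₂⟩
  have hw' : powDiag B d ≫ φ.inv.right = inclLeft B A := by
    rw [← hw, Category.assoc, h₁]
    exact Category.comp_id _
  constructor
  · intro i j hij E g hg
    refine disj_powProj hij g ((cancel_epi φ.hom.right).1 (tensor_hom_ext ?_ ?_))
    · rw [reassoc_of% hw, reassoc_of% hw, powDiag_proj_assoc, powDiag_proj_assoc]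
    · simpa using hg
  · intro D β y h
    refine isZero_of_powRing_hom (φ.inv.right ≫ tensorDesc β y) fun i E g hg => h i g ?_
    have hβ : powDiag B d ≫ (φ.inv.right ≫ tensorDesc β y) ≫ g = β ≫ g := by
      rw [Category.assoc, reassoc_of% hw', inclLeft_desc_assoc]
    rw [hβ] at hg
    have := congrArg (fun t => inclRight B A ≫ φ.hom.right ≫ t) hg
    rw [Category.assoc, reassoc_of% h₁, inclRight_desc_assoc] at this
    rw [this]
    simp

theorem isSplit_of_iso (φ : A ≅ unitPow K d) :
    IsSplit fun i => φ.hom ≫ powProj (CommMon.trivial K) d i := by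
  constructor
  · intro i j hij E g hg
    exact disj_powProj hij g ((cancel_epi φ.hom).1 (by simpa using hg))
  · intro D β y h
    refine isZero_of_powRing_hom (φ.inv ≫ y) fun i E g hg => h i g ?_
    -- The unit ring is initial, so every ring is uniquely an algebra over it.
    rw [Subsingleton.elim (powDiag (CommMon.trivial K) d ≫ (φ.inv ≫ y) ≫ g) (β ≫ g)] at hg
    have := congrArg (φ.hom ≫ ·) hg
    simpa using this.symm

/-- A ring which is split by `d` points over `B` has degree `d` if a ring of `d + 1` points with a
homomorphism from `B` has to vanish. -/
theorem IsSplit.deg_eq (hA : IsSep A) {x : Fin d → (A ⟶ B)} (hx : IsSplit x) (hB : ¬ IsZero B.X)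
    (h : ∀ (S : CommMon K) (_ : Fin (d + 1) → (A ⟶ S)), IsZero (tensorRing B S).X → IsZero S.X) :
    deg A = d := by
  obtain ⟨a, b, ha, hb, -⟩ := (splittingTower hA).exists_isConf d
  -- The `d` points in `B` are a homomorphism from the `d`-th stage to `B ≠ 0`. Over `B ⊗ A⁽ᵈ⁺¹⁾`
  -- there would be `d + 1` disjoint points, so this ring is zero.
  refine deg_eq_of_isConf hA ha hb (fun h0 => ?_) (h _ b ?_)
  · obtain ⟨w, -⟩ := ha.exists_desc x hx.disj
    exact hB (isZero_of_hom w h0)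
  · exact hx.isZero_of_lt (inclLeft _ _)
      (fun k l hkl => Disj.comp (hb.disj hkl) (inclRight B _)) (Nat.lt_succ_self d)

end Splitting

/-! ### Splitting after a tensor functor -/

noncomputable section Functors

variable {K : Type u} [Category.{v} K] [MonoidalCategory K] [Preadditive K]
  [MonoidalPreadditive K] [SymmetricCategory K] [IsIdempotentComplete K]
  {L : Type u'} [Category.{v'} L] [MonoidalCategory L] [Preadditive L]
  [MonoidalPreadditive L] [SymmetricCategory L] [IsIdempotentComplete L]
  (F : K ⥤ L) [F.Braided] [F.Additive]
  {A C C' D R S : CommMon K} {B E : CommMon L} {n d : ℕ}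

/-- The image of a point. -/
def mapPt (e : Pt C) : Pt (F.mapCommMon.obj C) := (Functor.LaxMonoidal.ε F ≫ F.map e.toHom : _ ⟶ F.obj C.X)

theorem mapPt_one : mapPt F (1 : Pt C) = 1 := rfl

theorem mapPt_zero : mapPt F (0 : Pt C) = 0 := by
  change Functor.LaxMonoidal.ε F ≫ F.map 0 = 0
  rw [F.map_zero, comp_zero]

theorem mapPt_add (a b : Pt C) : mapPt F (a + b) = mapPt F a + mapPt F b := by
  change Functor.LaxMonoidal.ε F ≫ F.map (a.toHom + b.toHom) = _
  rw [F.map_add, Preadditive.comp_add]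
  rfl

theorem mapPt_sum {J : Type*} (s : Finset J) (a : J → Pt C) :
    mapPt F (∑ i ∈ s, a i) = ∑ i ∈ s, mapPt F (a i) := by
  classical
  induction s using Finset.induction_on with
  | empty => simp [mapPt_zero]
  | insert i s hi ih => rw [Finset.sum_insert hi, Finset.sum_insert hi, mapPt_add, ih]

theorem map_mapPt (f : C ⟶ D) (e : Pt C) :
    Pt.map (F.mapCommMon.map f) (mapPt F e) = mapPt F (Pt.map f e) := by
  change (Functor.LaxMonoidal.ε F ≫ F.map e.toHom) ≫ F.map (homOf f) =
    Functor.LaxMonoidal.ε F ≫ F.map (e.toHom ≫ homOf f)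
  rw [F.map_comp, Category.assoc]

theorem smul_mapPt (e : Pt C) : (mapPt F e).smul = F.map e.smul := by
  change (λ_ (F.obj C.X)).inv ≫ ((Functor.LaxMonoidal.ε F ≫ F.map e.toHom) ▷ F.obj C.X) ≫
    Functor.LaxMonoidal.μ F C.X C.X ≫ F.map μ = F.map ((λ_ C.X).inv ≫ (e.toHom ▷ C.X) ≫ μ)
  rw [comp_whiskerRight_assoc, Functor.LaxMonoidal.μ_natural_left_assoc, F.map_comp, F.map_comp,
    ← Functor.LaxMonoidal.left_unitality_inv]
  simp

theorem IsLoc.mapCommMon {p : C ⟶ D} {e : Pt C} (h : IsLoc p e) :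
    IsLoc (F.mapCommMon.map p) (mapPt F e) := by
  obtain ⟨s, h₁, h₂⟩ := h
  refine ⟨F.map s, ?_, ?_⟩
  · change F.map s ≫ F.map (homOf p) = 𝟙 _
    rw [← F.map_comp, h₁, F.map_id]
  · change F.map (homOf p) ≫ F.map s = _
    rw [← F.map_comp, h₂, smul_mapPt]

theorem exists_iso_map_tensorRing (C D : CommMon K) :
    ∃ φ : tensorRing (F.mapCommMon.obj C) (F.mapCommMon.obj D) ≅ F.mapCommMon.obj (tensorRing C D),
      φ.hom = tensorDesc (F.mapCommMon.map (inclLeft C D)) (F.mapCommMon.map (inclRight C D)) := by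
  have h : homOf (tensorDesc (F.mapCommMon.map (inclLeft C D)) (F.mapCommMon.map (inclRight C D))) =
      Functor.LaxMonoidal.μ F C.X D.X := by
    change (F.map (homOf (inclLeft C D)) ⊗ₘ F.map (homOf (inclRight C D))) ≫
      Functor.LaxMonoidal.μ F _ _ ≫ F.map μ = _
    rw [Functor.LaxMonoidal.μ_natural_assoc, ← F.map_comp, incl_tensor_mul, F.map_id, Category.comp_id]
  refine exists_iso_of_inverse _ (Functor.OplaxMonoidal.δ F C.X D.X) ?_ ?_
  · rw [h]
    exact Functor.Monoidal.μ_δ F C.X D.X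
  · rw [h]
    exact Functor.Monoidal.δ_μ F C.X D.X

theorem exists_map_tensorDesc (u : F.mapCommMon.obj C ⟶ E) (v : F.mapCommMon.obj D ⟶ E) :
    ∃ w : F.mapCommMon.obj (tensorRing C D) ⟶ E,
      F.mapCommMon.map (inclLeft C D) ≫ w = u ∧ F.mapCommMon.map (inclRight C D) ≫ w = v := by
  obtain ⟨φ, hφ⟩ := exists_iso_map_tensorRing F C D
  refine ⟨φ.inv ≫ tensorDesc u v, ?_, ?_⟩
  · rw [← inclLeft_desc (F.mapCommMon.map (inclLeft C D)) (F.mapCommMon.map (inclRight C D)), ← hφ]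
    simp
  · rw [← inclRight_desc (F.mapCommMon.map (inclLeft C D)) (F.mapCommMon.map (inclRight C D)), ← hφ]
    simp

theorem map_tensorRing_hom_ext {w w' : F.mapCommMon.obj (tensorRing C D) ⟶ E}
    (h₁ : F.mapCommMon.map (inclLeft C D) ≫ w = F.mapCommMon.map (inclLeft C D) ≫ w')
    (h₂ : F.mapCommMon.map (inclRight C D) ≫ w = F.mapCommMon.map (inclRight C D) ≫ w') :
    w = w' := by
  obtain ⟨φ, hφ⟩ := exists_iso_map_tensorRing F C D
  refine (cancel_epi φ.hom).1 (tensor_hom_ext ?_ ?_)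
  · simpa [hφ] using h₁
  · simpa [hφ] using h₂

/-- Test rings in `L` need not come from `K`, so the equation `eqPt = 0` is transported instead:
agreement after `F` makes the image of this idempotent equal to `1`. -/
theorem Disj.mapCommMon (hA : IsSep A) {x y : A ⟶ R} (h : Disj x y) :
    Disj (F.mapCommMon.map x) (F.mapCommMon.map y) := by
  intro E g hg
  have hz : F.mapCommMon.map (tensorDesc x y) ≫ g =
      F.mapCommMon.map (codiag A) ≫ F.mapCommMon.map x ≫ g := by
    apply map_tensorRing_hom_ext
    · rw [← Functor.map_comp_assoc, inclLeft_desc, ← Functor.map_comp_assoc, inclLeft_desc,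
        CategoryTheory.Functor.map_id, Category.id_comp]
    · rw [← Functor.map_comp_assoc, inclRight_desc, ← Functor.map_comp_assoc, inclRight_desc,
        CategoryTheory.Functor.map_id, Category.id_comp, hg]
  have h₀ := (eqPt_eq_zero_iff hA).2 h
  have := congrArg (fun t => Pt.map t (mapPt F hA.choose)) hz
  simp only [Pt.map_comp, map_mapPt] at this
  rw [hA.choose_spec.map_eq_one, map_one, mapPt_one, map_one] at this
  change Pt.map g (mapPt F (eqPt hA x y)) = 1 at this
  rw [h₀, mapPt_zero, map_zero] at this
  exact (isZero_iff_one_eq_zero E).2 this.symm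

theorem nonempty_map_trivial_hom (E : CommMon L) :
    Nonempty (F.mapCommMon.obj (CommMon.trivial K) ⟶ E) := by
  let ε' : CommMon.trivial L ⟶ F.mapCommMon.obj (CommMon.trivial K) := default
  have hε : homOf ε' = Functor.LaxMonoidal.ε F := by
    have h := IsMonHom.one_hom (homOf ε')
    have h' : homOf ε' = Functor.LaxMonoidal.ε F ≫ F.map (𝟙 _) := (Category.id_comp _).symm.trans h
    rw [h', F.map_id]
    exact Category.comp_id _
  obtain ⟨φ, -⟩ := exists_iso_of_inverse ε' (Functor.OplaxMonoidal.η F)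
    (by rw [hε]; exact Functor.Monoidal.ε_η F) (by rw [hε]; exact Functor.Monoidal.η_ε F)
  exact ⟨φ.inv ≫ default⟩

/-- Pairwise disjoint points of `F A` in `B` extend to the image of the ring representing tuples of
disjoint points of `A`. -/
theorem exists_map_isConf_desc (hA : IsSep A) [HasBinaryBiproducts K]
    {x : Fin d → (F.mapCommMon.obj A ⟶ B)}
    (hx : Pairwise fun k l => Disj (x k) (x l)) (n : ℕ) (hn : n ≤ d) {R : CommMon K}
    {a : Fin n → (A ⟶ R)} (ha : IsConf a) :
    ∃ w : F.mapCommMon.obj R ⟶ B, ∀ k, F.mapCommMon.map (a k) ≫ w = x (Fin.castLE hn k) := by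
  induction n generalizing R with
  | zero =>
    obtain ⟨φ, -⟩ := ha.exists_iso (isConf_zero (Iso.refl (CommMon.trivial K)) (fun k => k.elim0))
    obtain ⟨w⟩ := nonempty_map_trivial_hom F B
    exact ⟨F.mapCommMon.map φ.hom ≫ w, fun k => k.elim0⟩
  | succ n ih =>
    obtain ⟨a', -, ha', -⟩ := (splittingTower hA).exists_isConf n
    obtain ⟨f, hf⟩ := ha'.exists_desc (fun k => a k.castSucc)
      (pairwise_comp_castSucc (r := Disj) ha.disj)
    obtain ⟨w₀, hw₀⟩ := ih (Nat.le_of_succ_le hn) ha'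
    -- `t` combines the first `n` points with the next one. By disjointness it kills the image of
    -- every `pointPt`, so it descends to the image of the complementary factor, which is `F` of the
    -- next stage.
    obtain ⟨t, ht₁, ht₂⟩ := exists_map_tensorDesc F w₀ (x (Fin.castLE hn (Fin.last n)))
    have hzero (k : Fin n) : Pt.map t (mapPt F (pointPt hA (a' k))) = 0 := by
      have hl := (isLoc_pointPt hA (a' k)).mapCommMon F
      refine idem_eq_zero (by rw [← map_mul, hl.idem]) fun g hg => ?_
      rw [← Pt.map_comp] at hg
      obtain ⟨z, hz⟩ := hl.exists_lift _ hg
      have h₁ := congrArg (F.mapCommMon.map (inclLeft _ A) ≫ ·) hz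
      have h₂ := congrArg (F.mapCommMon.map (inclRight _ A) ≫ ·) hz
      simp only [← Functor.map_comp_assoc, inclLeft_desc, inclRight_desc, reassoc_of% ht₁,
        reassoc_of% ht₂, CategoryTheory.Functor.map_id, Category.id_comp] at h₁ h₂
      rw [h₁, reassoc_of% (hw₀ k)] at h₂
      refine hx (fun h => ?_) g h₂
      exact (Fin.castSucc_lt_last k).ne (Fin.castLE_injective hn h)
    obtain ⟨w, hw⟩ := ((ha'.isLoc_next hA ha fun k => (hf k).symm).mapCommMon F).exists_lift t (by
      have : mapPt F (1 - ∑ k, pointPt hA (a' k)) = 1 - ∑ k, mapPt F (pointPt hA (a' k)) := by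
        rw [eq_sub_iff_add_eq, ← mapPt_sum, ← mapPt_add, sub_add_cancel, mapPt_one]
      rw [this, map_sub, map_sum, Finset.sum_eq_zero fun k _ => hzero k, map_one, sub_zero])
    have h₁ := congrArg (F.mapCommMon.map (inclLeft _ A) ≫ ·) hw
    have h₂ := congrArg (F.mapCommMon.map (inclRight _ A) ≫ ·) hw
    simp only [← Functor.map_comp_assoc, inclLeft_desc, inclRight_desc, ht₁, ht₂] at h₁ h₂
    refine ⟨w, fun k => ?_⟩
    refine Fin.lastCases ?_ (fun k => ?_) k
    · exact h₂
    · rw [← hf, Functor.map_comp, Category.assoc, h₁, hw₀]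
      rfl

/-- The degree of `A` can be computed after a functor which detects the vanishing of `A`-algebras
and splits `A`. -/
theorem deg_eq_of_isSplit_map (hA : IsSep A) [HasBinaryBiproducts K]
    {x : Fin d → (F.mapCommMon.obj A ⟶ B)} (hx : IsSplit x) (hB : ¬ IsZero B.X)
    (h : ∀ (S : CommMon K) (_ : A ⟶ S), IsZero (F.obj S.X) → IsZero S.X)
    (β : ∀ S : CommMon K, B ⟶ F.mapCommMon.obj S) : deg A = d := by
  obtain ⟨a, b, ha, hb, -⟩ := (splittingTower hA).exists_isConf d
  refine deg_eq_of_isConf hA ha hb (fun h0 => ?_) (h _ (b (Fin.last d)) ?_)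
  · obtain ⟨w, -⟩ := exists_map_isConf_desc F hA hx.disj d le_rfl ha
    exact hB (isZero_of_hom w (F.map_isZero h0))
  · exact hx.isZero_of_lt (β _) (a := fun k => F.mapCommMon.map (b k))
      (fun k l hkl => Disj.mapCommMon F hA (hb.disj hkl)) (Nat.lt_succ_self d)

end Functors

/-! ### Vanishing of objects and of nilpotent rings -/

section Vanishing

variable {K : Type u} [Category.{v} K] [Preadditive K] [MonoidalCategory K]
  [MonoidalPreadditive K]

theorem isZero_tensor_left {X : K} (Y : K) (h : IsZero X) : IsZero (X ⊗ Y) :=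
  (tensorRight Y).map_isZero h

theorem isZero_tensor_right {Y : K} (X : K) (h : IsZero Y) : IsZero (X ⊗ Y) :=
  (tensorLeft X).map_isZero h

theorem isZero_of_isZero_unit (h : IsZero (𝟙_ K)) (X : K) : IsZero X :=
  (isZero_tensor_left X h).of_iso (λ_ X).symm

/-- The morphism from `X` to a zero object becomes an isomorphism after `F`. -/
theorem isZero_of_isZero_map {L : Type u'} [Category.{v'} L] [HasZeroMorphisms L]
    [HasZeroObject K] (F : K ⥤ L) [F.PreservesZeroMorphisms] [F.ReflectsIsomorphisms] {X : K}
    (hX : IsZero (F.obj X)) : IsZero X := by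
  obtain ⟨Z, hZ⟩ := HasZeroObject.zero (C := K)
  have : IsIso (F.map (0 : X ⟶ Z)) := ⟨0, hX.eq_of_src _ _, (F.map_isZero hZ).eq_of_src _ _⟩
  have := isIso_of_reflects_iso (0 : X ⟶ Z) F
  exact hZ.of_iso (asIso (0 : X ⟶ Z))

variable [BraidedCategory K]

/-- A `⊗`-nilpotent ring vanishes. -/
theorem isZero_of_isTensorNilpotent {R : CommMon K} (h : IsTensorNilpotent R.X) : IsZero R.X := by
  obtain ⟨m, hm⟩ := h
  -- The unit of `R` factors through every tensor power, by tensoring units and then multiplying. A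
  -- vanishing power therefore gives `1 = 0`.
  have key (m : ℕ) : ∃ (i : 𝟙_ K ⟶ tensorPow R.X m) (p : tensorPow R.X m ⟶ R.X), i ≫ p = η := by
    induction m with
    | zero => exact ⟨𝟙 _, η, Category.id_comp _⟩
    | succ m ih =>
      obtain ⟨i, p, hip⟩ := ih
      refine ⟨(λ_ _).inv ≫ (η ⊗ₘ i), (𝟙 _ ⊗ₘ p) ≫ μ, ?_⟩
      change ((λ_ (𝟙_ K)).inv ≫ (η ⊗ₘ i : 𝟙_ K ⊗ 𝟙_ K ⟶ R.X ⊗ tensorPow R.X m)) ≫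
        (𝟙 R.X ⊗ₘ p) ≫ μ = η
      rw [Category.assoc, tensorHom_comp_tensorHom_assoc, hip, Category.comp_id,
        MonObj.one_mul_hom, Iso.inv_hom_id_assoc]
  obtain ⟨i, p, hip⟩ := key m
  rw [isZero_iff_one_eq_zero]
  change η = 0
  rw [← hip, hm.eq_of_tgt i 0, zero_comp]
  rfl

end Vanishing

/-! ### Supports and thick tensor ideals -/

section Support

variable {K : Type u} [Category.{v} K] [Preadditive K] [HasZeroObject K] [HasShift K ℤ]
  [∀ n : ℤ, (shiftFunctor K n).Additive] [Pretriangulated K] [MonoidalCategory K]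
  [SymmetricCategory K]

/-- An `A`-algebra `S` is a direct summand of `S ⊗ A`. -/
noncomputable def retractOfHom {A S : CommMon K} (b : A ⟶ S) : Retract S.X (S.X ⊗ A.X) where
  i := homOf (inclLeft S A)
  r := homOf (tensorDesc (𝟙 S) b)
  retract := congrArg homOf (inclLeft_desc (𝟙 S) b)

theorem supp_subset_of_hom {A S : CommMon K} (b : A ⟶ S) : supp S.X ⊆ supp A.X := by
  intro P hP hA
  have := P.thick
  exact hP (P.carrier.prop_of_retract (retractOfHom b) (P.ideal _ _ hA))

/-- The thick `⊗`-ideals of `K`. -/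
structure IsThickIdeal (P : ObjectProperty K) : Prop where
  isTriangulated : P.IsTriangulated
  thick : P.IsStableUnderRetracts
  ideal (x y : K) : P y → P (x ⊗ y)

theorem isThickIdeal_isZero [MonoidalPreadditive K] :
    IsThickIdeal (fun x : K => IsZero x : ObjectProperty K) := by
  have thick : ObjectProperty.IsStableUnderRetracts (fun x : K => IsZero x) :=
    ⟨fun r h => by
      rw [IsZero.iff_id_eq_zero, ← r.retract, h.eq_of_tgt r.i 0, zero_comp]⟩
  exact
    { isTriangulated :=
        { exists_zero := ⟨_, isZero_zero K, isZero_zero K⟩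
          isStableUnderShiftBy := fun n => ⟨fun X hX => (shiftFunctor K n).map_isZero hX⟩
          toIsTriangulatedClosed₂ := .mk' fun T hT h₁ h₃ => T.isZero₂_of_isZero₁₃ hT h₁ h₃ }
      thick := thick
      ideal := fun x _ h => isZero_tensor_right x h }

theorem isThickIdeal_sUnion {c : Set (ObjectProperty K)} (hc : IsChain (· ≤ ·) c)
    (hne : c.Nonempty) (h : ∀ P ∈ c, IsThickIdeal P) :
    IsThickIdeal (fun x => ∃ P ∈ c, P x : ObjectProperty K) := by
  have thick : ObjectProperty.IsStableUnderRetracts (fun x : K => ∃ P ∈ c, P x) :=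
    ⟨fun r ⟨P, hP, hx⟩ => ⟨P, hP, (h P hP).thick.of_retract r hx⟩⟩
  refine
    { isTriangulated :=
        { exists_zero := ?_
          isStableUnderShiftBy := fun n => ⟨fun X ⟨P, hP, hx⟩ => ?_⟩
          toIsTriangulatedClosed₂ := .mk' fun T hT h₁ h₃ => ?_ }
      thick := thick
      ideal := fun x y ⟨P, hP, hy⟩ => ⟨P, hP, (h P hP).ideal x y hy⟩ }
  · obtain ⟨P, hP⟩ := hne
    obtain ⟨Z, hZ, hPZ⟩ := (h P hP).isTriangulated.exists_zero
    exact ⟨Z, hZ, P, hP, hPZ⟩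
  · have := (h P hP).isTriangulated
    exact ⟨P, hP, P.le_shift n _ hx⟩
  · obtain ⟨P, hP, hP₁⟩ := h₁
    obtain ⟨Q, hQ, hQ₃⟩ := h₃
    obtain ⟨U, hU, hU₁, hU₃⟩ : ∃ U ∈ c, U T.obj₁ ∧ U T.obj₃ := by
      rcases hc.total hP hQ with hPQ | hPQ
      · exact ⟨Q, hQ, hPQ _ hP₁, hQ₃⟩
      · exact ⟨P, hP, hP₁, hPQ _ hQ₃⟩
    have := (h U hU).isTriangulated
    have := (h U hU).thick
    exact ⟨U, hU, U.ext_of_isTriangulatedClosed₂ T hT hU₁ hU₃⟩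

variable [TTCategory K]

/-- The ideal quotient `(P : y)`. -/
theorem IsThickIdeal.colon {P : ObjectProperty K} (hP : IsThickIdeal P) (y : K) :
    IsThickIdeal (fun x => P (x ⊗ y) : ObjectProperty K) := by
  obtain ⟨_, _⟩ := TTCategory.exact_tensorRight y
  have := hP.isTriangulated
  have := hP.thick
  refine
    { isTriangulated := inferInstanceAs (P.inverseImage (tensorRight y)).IsTriangulated
      thick := ⟨fun r h => P.prop_of_retract (r.map (tensorRight y)) h⟩
      ideal := fun x z h => P.prop_of_iso (α_ x z y).symm (hP.ideal x _ h) }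

/-- A ring with empty support vanishes. -/
theorem isZero_of_supp_eq_empty {R : CommMon K} (h : supp R.X = ∅) : IsZero R.X := by
  have : MonoidalPreadditive K := TTCategory.preadditive
  by_contra hR
  -- A thick ideal maximal among those not containing `R` is shown to be prime; it then lies in the
  -- support of `R`.
  obtain ⟨P, -, hP⟩ := zorn_le_nonempty₀ {P : ObjectProperty K | IsThickIdeal P ∧ ¬ P R.X}
    (fun c hc hchain Q hQ => ⟨fun x => ∃ P ∈ c, P x,
      ⟨isThickIdeal_sUnion hchain ⟨Q, hQ⟩ fun P hP => (hc hP).1,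
        fun ⟨P, hP, hPR⟩ => (hc hP).2 hPR⟩, fun P hP x hx => ⟨P, hP, hx⟩⟩)
    (fun x => IsZero x) ⟨isThickIdeal_isZero, hR⟩
  obtain ⟨⟨hI, hPR⟩, hmax⟩ := hP
  have := hI.thick
  -- The ideal `(P : y)` contains `P` and also `x`, so by maximality it contains `R`.
  have hcolon (y : K) {x : K} (hxy : P (x ⊗ y)) (hx : ¬ P x) : P (R.X ⊗ y) := by
    by_contra hRy
    have := hmax (y := fun x => P (x ⊗ y)) ⟨hI.colon y, hRy⟩
      (fun z hz => P.prop_of_iso (β_ y z) (hI.ideal y z hz))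
    exact hx (this x hxy)
  let 𝔭 : Spc K :=
    { carrier := P
      isTriangulated := hI.isTriangulated
      thick := hI.thick
      ideal := hI.ideal
      proper := ⟨R.X, hPR⟩
      prime := fun x y hxy => by
        by_contra! hcon
        -- Using the quotient twice gives `R ⊗ y ∈ P`, then `R ⊗ R ∈ P`. The unit makes `R` a
        -- retract of `R ⊗ R`, a contradiction.
        have h₁ := hcolon y hxy hcon.1
        have h₂ := hcolon R.X (P.prop_of_iso (β_ R.X y) h₁) hcon.2
        exact hPR (P.prop_of_retract (retractOfHom (𝟙 R)) h₂) }
  exact Set.eq_empty_iff_forall_notMem.1 h 𝔭 hPR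

/-- If `B ⊗ S` vanishes, `S` is supported on `B`, then the ring `S` vanishes. -/
theorem isZero_of_supp_subset {S : CommMon K} {b : K} (h : supp S.X ⊆ supp b)
    (hS : IsZero (b ⊗ S.X)) : IsZero S.X := by
  refine isZero_of_supp_eq_empty (Set.eq_empty_iff_forall_notMem.2 fun P hP => ?_)
  have := P.isTriangulated
  have := P.thick
  obtain ⟨Z, hZ, hPZ⟩ := P.isTriangulated.exists_zero
  exact (P.prime _ _ (P.carrier.prop_of_iso (hZ.iso hS) hPZ)).elim (h hP) hP

end Support

end TTDegree

/-! ### The theorem on the degree -/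

open TTDegree

theorem theorem3p8 {K : Type u} [Category.{v} K] [Preadditive K] [HasZeroObject K] [HasShift K ℤ]
    [∀ n : ℤ, (shiftFunctor K n).Additive] [Pretriangulated K] [MonoidalCategory K]
    [SymmetricCategory K] [TTCategory K] (hK : ∃ x : K, ¬ IsZero x)
    (A : CommMon K) (hA : IsSeparableRing A.X) :
    -- splitting towers exist and any of them computes the degree
    (Nonempty (SplittingTower A) ∧ ∀ (T : SplittingTower A) (d : ℕ),
      deg A = d ↔ ¬ IsZero (T.obj d).X ∧ IsZero (T.obj (d + 1)).X) ∧
    -- the degree of a product of copies of the unit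
    (∀ n : ℕ, 1 ≤ n → deg (unitPow K n) = n) ∧
    -- splitting after extension of scalars to a stage of the tower
    (∀ (T : SplittingTower A) (n : ℕ), 1 ≤ n →
      Nonempty (extScalars (T.obj n) A ≅
        prodAlg (unitPowAlg (T.obj n) n) (Under.mk (T.map n)))) ∧
    -- complete splitting in finite degree
    (∀ (T : SplittingTower A) (d : ℕ), deg A = d →
      ¬ IsZero (T.obj d).X ∧ Nonempty (extScalars (T.obj d) A ≅ unitPowAlg (T.obj d) d)) ∧
    -- detecting the degree through a tt-functor
    (∀ {L : Type u'} [Category.{v'} L] [Preadditive L] [HasZeroObject L] [HasShift L ℤ]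
      [∀ n : ℤ, (shiftFunctor L n).Additive] [Pretriangulated L] [MonoidalCategory L]
      [SymmetricCategory L] [TTCategory L] (F : K ⥤ L) [F.Braided] [F.CommShift ℤ]
      [F.IsTriangulated] (d : ℕ),
      (((∃ y : L, ¬ IsZero y) ∧ IsWeaklyConservativeOn F (supp A.X)) ∨
        F.ReflectsIsomorphisms) →
      Nonempty (F.mapCommMon.obj A ≅ unitPow L d) → deg A = d) ∧
    -- detecting the degree through an extension of scalars
    (∀ (B : CommMon K), IsSeparableRing B.X → ¬ IsZero B.X →
      (supp A.X ⊆ supp B.X ∨ IsLocalTT K) →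
      ∀ d : ℕ, Nonempty (extScalars B A ≅ unitPowAlg B d) → deg A = d) := by
  have hK₁ : MonoidalPreadditive K := TTCategory.preadditive
  have hK₂ : IsIdempotentComplete K := TTCategory.idempotentComplete
  have hA' : IsSep A := hA.isSep
  have hunit : ¬ IsZero (CommMon.trivial K).X := fun h =>
    hK.elim fun x hx => hx (isZero_of_isZero_unit h x)
  refine ⟨⟨⟨splittingTower hA'⟩, fun T d => ?_⟩, fun n _ => ?_, fun T n _ => ?_,
    fun T d hd => ?_, ?_, fun B _ hB hAB d ⟨φ⟩ => ?_⟩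
  · rw [deg_eq_iff, T.hasDegree_iff]
  -- The splitting takes place over the unit itself, and tensoring with the unit detects vanishing.
  · exact (isSplit_of_iso (Iso.refl _)).deg_eq (isSep_unitPow n) hunit
      fun S _ hS => hS.of_iso (λ_ S.X).symm
  · obtain ⟨a, b, ha, hb, hab⟩ := T.exists_isConf n
    exact ha.extScalars_iso hA' hb hab
  · rw [deg_eq_iff, T.hasDegree_iff] at hd
    obtain ⟨a, b, ha, hb, hab⟩ := T.exists_isConf d
    exact ⟨hd.1, ha.extScalars_iso_of_isZero hA' hb hab hd.2⟩
  · intro L _ _ _ _ _ _ _ _ _ F _ _ _ d hF ⟨φ⟩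
    have hL₁ : MonoidalPreadditive L := TTCategory.preadditive
    have hL₂ : IsIdempotentComplete L := TTCategory.idempotentComplete
    refine deg_eq_of_isSplit_map F hA' (isSplit_of_iso φ) ?_ (fun S b hS => ?_) fun S => default
    · intro h
      rcases hF with ⟨⟨y, hy⟩, -⟩ | hcons
      · exact hy (isZero_of_isZero_unit h y)
      -- For conservative `F`, the target is nonzero automatically: otherwise `F` would kill the
      -- unit of `K`.
      · exact hunit (isZero_of_isZero_map F (isZero_of_isZero_unit h _))
    · rcases hF with ⟨-, hw⟩ | hcons
      · exact isZero_of_isTensorNilpotent (hw S.X (supp_subset_of_hom b) hS)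
      · exact isZero_of_isZero_map F hS
  · refine (isSplit_of_extScalars_iso φ).deg_eq hA' hB fun S b hS => ?_
    rcases hAB with hsupp | hloc
    -- There are `d + 1 ≥ 1` points, so even for `d = 0` the stage `S` is an `A`-algebra and is
    -- supported on `A`.
    · exact isZero_of_supp_subset ((supp_subset_of_hom (b 0)).trans hsupp) hS
    · exact (hloc _ _ hS).elim (fun h => absurd (isZero_of_isTensorNilpotent h) hB)
        isZero_of_isTensorNilpotent
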